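/- Let $C$ be a finite set of categories and let $m=(m_c)_{c\in C}$ be a probability vector with all $m_c>0$. The full model consists of all probability vectors $q$ on $C$ (zero entries are admitted in estimates). Let $R$ be a finite collection of pairwise disjoint subsets of $C$ and consider the non-overlapping $m$-aggregation submodel, i.e. the set of probability vectors $q$ that satisfy the restriction equations $\sum_{c\in G}q_c=b_G$ for $G\in R$, where the $b_G$ are known constants; assume that the true vector $m$ belongs to this submodel. The groups are the nonempty sets in $R$ together with the set of the categories that lie in no member of $R$, if this set is nonempty (its total probability is then also determined). Let $I$ be the number of groups and assume $I\ge 2$. The equation fixing the total probability of a group is called solid if the group consists of a single category; assume that none of these $I$ equations is solid, that is, every group contains at least two categories. Draw $n$ independent observations from $m$. For a model let $\widehat m$ be the maximum likelihood estimate (a maximizer of the likelihood over the model), and measure it by the risk $E\bigl[\sum_{c}\widehat m_c\log(\widehat m_c/m_c)\bigr]$, with $0\log 0=0$. For the submodel, the expectation is conditional on every group being observed at least once; for the full model it may be taken either unconditionally or under the same conditioning. Then there are real numbers $a_{\mathrm{full}}$ and $a_{\mathrm{sub}}$ such that, as $n\to\infty$, the risk of the full model (in both versions) is $$\frac{|C|-1}{2n}+\frac{a_{\mathrm{full}}}{n^2}+o(n^{-2}),$$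 the risk of the submodel is $$\frac{|C|-I}{2n}+\frac{a_{\mathrm{sub}}}{n^2}+o(n^{-2}),$$ and $a_{\mathrm{sub}}>a_{\mathrm{full}}$: the second-order coefficient of the submodel is strictly larger than that of the full model. -/

import Mathlib

open Filter Asymptotics

namespace MAggregation

noncomputable section

/-- The full multinomial model on the finite set `C` of categories: all probability vectors.
Zero entries are allowed, so that the maximum likelihood estimate exists even if some
category is not observed. The true probability vector is assumed positive separately. -/
def fullModel (C : Type*) [Fintype C] : Set (C → ℝ) :=
  stdSimplex ℝ C

/-- The `m`-aggregation submodel with one restriction equation `∑ c ∈ G, q c = b G` for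
each set `G` of categories in the family `R`. -/
def aggregationSubmodel {C : Type*} [Fintype C] (R : Finset (Finset C))
    (b : Finset C → ℝ) : Set (C → ℝ) :=
  {q | q ∈ fullModel C ∧ ∀ G ∈ R, ∑ c ∈ G, q c = b G}

/-- The restriction equations are non-overlapping: no category probability occurs in two of
them. -/
def NonOverlapping {C : Type*} (R : Finset (Finset C)) : Prop :=
  ∀ G ∈ R, ∀ H ∈ R, G ≠ H → Disjoint G H

/-- The categories that occur in no restriction equation. -/
def leftover {C : Type*} [Fintype C] [DecidableEq C] (R : Finset (Finset C)) : Finset C :=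
  Finset.univ \ R.biUnion id

/-- The groups of categories: the categories of each restriction equation form a group, and so
do the categories that occur in none of them, if there are any. -/
def groups {C : Type*} [Fintype C] [DecidableEq C] (R : Finset (Finset C)) :
    Finset (Finset C) :=
  (insert (leftover R) R).erase ∅

/-- The equation that fixes the total probability of the group `G` is solid if `G` consists of a
single category. -/
def IsSolid {C : Type*} (G : Finset C) : Prop :=
  G.card = 1

/-- The probability of the sample `ω` of `n` independent trials under the probability vector `q`
(as a function of `q`, the likelihood). -/
def likelihood {C : Type*} {n : ℕ} (q : C → ℝ) (ω : Fin n → C) : ℝ :=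
  ∏ k, q (ω k)

/-- `q` is a maximum likelihood estimate in the model `M` from the sample `ω`. -/
def IsMLE {C : Type*} {n : ℕ} (M : Set (C → ℝ)) (ω : Fin n → C) (q : C → ℝ) : Prop :=
  q ∈ M ∧ ∀ q' ∈ M, likelihood q' ω ≤ likelihood q ω

/-- The Kullback-Leibler divergence `∑ q log (q / m)`, with `0 log 0 = 0`. -/
def klDivergence {C : Type*} [Fintype C] (q m : C → ℝ) : ℝ :=
  ∑ c, q c * Real.log (q c / m c)

/-- The samples of size `n` in which every group is observed at least once. -/
def observed {C : Type*} [Fintype C] [DecidableEq C] (R : Finset (Finset C)) (n : ℕ) :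
    Set (Fin n → C) :=
  {ω | ∀ G ∈ groups R, ∃ k, ω k ∈ G}

/-- The Kullback-Leibler risk `E[D[T : m] | K n]` of the estimator `T` from `n` independent
trials with true probability vector `m`, conditional on the sample lying in `K n`. -/
def risk {C : Type*} [Fintype C] (m : C → ℝ) (K : (n : ℕ) → Set (Fin n → C))
    (T : (n : ℕ) → (Fin n → C) → C → ℝ) (n : ℕ) : ℝ :=
  (∑ ω : Fin n → C,
      (K n).indicator (fun ω => likelihood m ω * klDivergence (T n ω) m) ω) /
    ∑ ω : Fin n → C, (K n).indicator (fun ω => likelihood m ω) ω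

/-- `r n = a₁ / n + a₂ / n ^ 2 + o(n ^ (-2))` as `n → ∞`. -/
def HasSecondOrderExpansion (r : ℕ → ℝ) (a₁ a₂ : ℝ) : Prop :=
  (fun n : ℕ => r n - (a₁ / (n : ℝ) + a₂ / (n : ℝ) ^ 2)) =o[atTop]
    (fun n : ℕ => 1 / (n : ℝ) ^ 2)

end

end MAggregation

namespace MAggregation

noncomputable section

/-! ### Taylor bounds for `t log t` -/

/-! Both models fix the group totals of a partition of `C`: the full model is the case of one group.
When every group is observed, the maximum likelihood estimate of category `c` in group `G` is `b_G
X_c`, with `b_G` the probability of `G` and `X_c` the relative frequency of `c` among the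
observations in `G` (`IsMLE.eq_groupProb_mul_groupFreq`). The divergence is then a sum of terms `b_G
X_c log (X_c / p_c)`, `p_c = m_c / b_G`.

The number `k` of observations in `G` is binomial with parameters `n`, `b_G`, and given `k` the
count of `c` is binomial with parameters `k`, `p_c` (`sampleExp_count`). A Taylor bound for `t log
t` and the first six central moments give the conditional mean of `X_c log (X_c / p_c)` as `(1 - p)
/ (2k) + (1/p - p) / (12k²) + O(k⁻³)`. Averaging over `k` needs inverse moments of a binomial
variable; these are tractable once powers of `1/k` are replaced by reciprocals of rising products
(`exists_binomExp_freqEntropy_expansion`). Unobserved groups have probability `O(n⁻³)` and the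
divergence formula is bounded, so conditioning changes neither coefficient.

Summing over a group yields the second coefficient `∑_G ((|G| - 1)/2 · (1/b_G - 1) - 1/(12 b_G)) +
(1/12) ∑_c 1/m_c`. The last sum is common to both models, and the full model adds only `-1/12` to
it. With `|G| ≥ 2` and `∑ 1/b_G ≥ I²`, the submodel adds at least `5I²/12 - I/2`. The difference is
at least `(5I - 1)(I - 1)/12 > 0`. -/

theorem nonneg_of_hasDerivAt_mul_sub_one_nonneg {f f' : ℝ → ℝ} (h1 : f 1 = 0)
    (hd : ∀ t, 0 < t → HasDerivAt f (f' t) t) (hs : ∀ t, 0 < t → 0 ≤ f' t * (t - 1))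
    {t : ℝ} (ht : 0 < t) : 0 ≤ f t := by
  rcases lt_trichotomy t 1 with h | h | h
  · obtain ⟨c, hc, e⟩ := exists_hasDerivAt_eq_slope f f' h
      (fun x hx => (hd x (ht.trans_le hx.1)).continuousAt.continuousWithinAt)
      (fun x hx => hd x (ht.trans hx.1))
    have := hs c (ht.trans hc.1)
    rw [eq_div_iff (by linarith), h1] at e
    have : f' c ≤ 0 := by
      by_contra! h'
      nlinarith [hc.2]
    nlinarith
  · rw [h, h1]
  · obtain ⟨c, hc, e⟩ := exists_hasDerivAt_eq_slope f f' h
      (fun x hx => (hd x (by linarith [hx.1])).continuousAt.continuousWithinAt)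
      (fun x hx => hd x (by linarith [hx.1]))
    have := hs c (by linarith [hc.1])
    rw [eq_div_iff (by linarith), h1] at e
    have : 0 ≤ f' c := by
      by_contra! h'
      nlinarith [hc.1]
    nlinarith

theorem mul_sub_one_nonneg_of_hasDerivAt_nonneg {f f' : ℝ → ℝ} (h1 : f 1 = 0)
    (hd : ∀ t, 0 < t → HasDerivAt f (f' t) t) (hs : ∀ t, 0 < t → 0 ≤ f' t)
    {t : ℝ} (ht : 0 < t) : 0 ≤ f t * (t - 1) := by
  rcases lt_trichotomy t 1 with h | h | h
  · obtain ⟨c, hc, e⟩ := exists_hasDerivAt_eq_slope f f' h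
      (fun x hx => (hd x (ht.trans_le hx.1)).continuousAt.continuousWithinAt)
      (fun x hx => hd x (ht.trans hx.1))
    have := hs c (ht.trans hc.1)
    rw [eq_div_iff (by linarith), h1] at e
    nlinarith [mul_nonneg this (sq_nonneg (t - 1))]
  · rw [h, h1, zero_mul]
  · obtain ⟨c, hc, e⟩ := exists_hasDerivAt_eq_slope f f' h
      (fun x hx => (hd x (by linarith [hx.1])).continuousAt.continuousWithinAt)
      (fun x hx => hd x (by linarith [hx.1]))
    have := hs c (by linarith [hc.1])
    rw [eq_div_iff (by linarith), h1] at e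
    nlinarith [mul_nonneg this (sq_nonneg (t - 1))]

theorem hasDerivAt_sub_one_pow (n : ℕ) (t : ℝ) :
    HasDerivAt (fun t : ℝ => (t - 1) ^ n) (n * (t - 1) ^ (n - 1)) t := by
  simpa using ((hasDerivAt_id' t).sub_const 1).fun_pow n

/-- The derivative of the difference is `(t - 1)^5 / t`, which has the sign of `t - 1`. -/
theorem log_le_taylor {t : ℝ} (ht : 0 < t) :
    Real.log t ≤ (t - 1) ^ 1 + -1 / 2 * (t - 1) ^ 2 + 1 / 3 * (t - 1) ^ 3
      + -1 / 4 * (t - 1) ^ 4 + 1 / 5 * (t - 1) ^ 5 := by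
  have key := nonneg_of_hasDerivAt_mul_sub_one_nonneg
    (f := fun t => (t - 1) ^ 1 + -1 / 2 * (t - 1) ^ 2 + 1 / 3 * (t - 1) ^ 3
      + -1 / 4 * (t - 1) ^ 4 + 1 / 5 * (t - 1) ^ 5 - Real.log t)
    (f' := fun t => (t - 1) ^ 5 / t) (by simp)
    (fun t ht => by
      refine HasDerivAt.congr_deriv ((((((hasDerivAt_sub_one_pow 1 t).fun_add
        ((hasDerivAt_sub_one_pow 2 t).const_mul (-1 / 2))).fun_add
        ((hasDerivAt_sub_one_pow 3 t).const_mul (1 / 3))).fun_add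
        ((hasDerivAt_sub_one_pow 4 t).const_mul (-1 / 4))).fun_add
        ((hasDerivAt_sub_one_pow 5 t).const_mul (1 / 5))).fun_sub
        (Real.hasDerivAt_log ht.ne')) ?_
      push_cast
      field_simp
      ring)
    (fun t ht => by
      have : (t - 1) ^ 5 / t * (t - 1) = ((t - 1) ^ 3) ^ 2 / t := by ring
      rw [this]
      positivity) ht
  linarith

theorem log_sub_taylor_mul_nonneg {t : ℝ} (ht : 0 < t) :
    0 ≤ (Real.log t - ((t - 1) ^ 1 + -1 / 2 * (t - 1) ^ 2 + 1 / 3 * (t - 1) ^ 3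
      + -1 / 4 * (t - 1) ^ 4)) * (t - 1) :=
  mul_sub_one_nonneg_of_hasDerivAt_nonneg
    (f := fun t => Real.log t - ((t - 1) ^ 1 + -1 / 2 * (t - 1) ^ 2 + 1 / 3 * (t - 1) ^ 3
      + -1 / 4 * (t - 1) ^ 4))
    (f' := fun t => (t - 1) ^ 4 / t) (by simp)
    (fun t ht => by
      refine HasDerivAt.congr_deriv ((Real.hasDerivAt_log ht.ne').fun_sub ((((hasDerivAt_sub_one_pow 1 t).fun_add
        ((hasDerivAt_sub_one_pow 2 t).const_mul (-1 / 2))).fun_add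
        ((hasDerivAt_sub_one_pow 3 t).const_mul (1 / 3))).fun_add
        ((hasDerivAt_sub_one_pow 4 t).const_mul (-1 / 4)))) ?_
      push_cast
      field_simp
      ring)
    (fun t ht => by positivity) ht

/-- The Taylor polynomial of degree five of `t log t` at `1`, as a function of `t - 1`. -/
def mulLogTaylor (s : ℝ) : ℝ :=
  s + s ^ 2 / 2 - s ^ 3 / 6 + s ^ 4 / 12 - s ^ 5 / 20

/-- The derivative of the difference is the remainder of `log` at order four, whose sign is that of
`t - 1`. Stopping at odd degree makes the remainder one-signed. -/
theorem mulLogTaylor_le {t : ℝ} (ht : 0 ≤ t) : mulLogTaylor (t - 1) ≤ t * Real.log t := by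
  rcases ht.eq_or_lt with rfl | ht
  · norm_num [mulLogTaylor]
  have key := nonneg_of_hasDerivAt_mul_sub_one_nonneg
    (f := fun t => t * Real.log t - ((t - 1) ^ 1 + 1 / 2 * (t - 1) ^ 2 + -1 / 6 * (t - 1) ^ 3
      + 1 / 12 * (t - 1) ^ 4 + -1 / 20 * (t - 1) ^ 5))
    (f' := fun t => Real.log t - ((t - 1) ^ 1 + -1 / 2 * (t - 1) ^ 2 + 1 / 3 * (t - 1) ^ 3
      + -1 / 4 * (t - 1) ^ 4)) (by simp)
    (fun t ht => by
      refine HasDerivAt.congr_deriv (((hasDerivAt_id' t).fun_mul (Real.hasDerivAt_log ht.ne')).fun_sub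
        (((((hasDerivAt_sub_one_pow 1 t).fun_add
        ((hasDerivAt_sub_one_pow 2 t).const_mul (1 / 2))).fun_add
        ((hasDerivAt_sub_one_pow 3 t).const_mul (-1 / 6))).fun_add
        ((hasDerivAt_sub_one_pow 4 t).const_mul (1 / 12))).fun_add
        ((hasDerivAt_sub_one_pow 5 t).const_mul (-1 / 20)))) ?_
      push_cast
      field_simp
      ring)
    (fun t ht => log_sub_taylor_mul_nonneg ht) ht
  unfold mulLogTaylor
  linarith

/-- Multiplying the quintic bound for `log t` by `t = 1 + (t - 1)` gives exactly the right-hand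
side, which is also exact at `t = 0`. An error of sixth order suffices, since the sixth central
moment is `O(k³)` and is divided by `k⁶`. -/
theorem mul_log_le {t : ℝ} (ht : 0 ≤ t) :
    t * Real.log t ≤ mulLogTaylor (t - 1) + (t - 1) ^ 6 / 5 := by
  rcases ht.eq_or_lt with rfl | ht
  · norm_num [mulLogTaylor]
  have := mul_le_mul_of_nonneg_left (log_le_taylor ht) ht.le
  unfold mulLogTaylor
  linarith

/-! ### Binomial expectations -/

/-- The expectation of `f N` for a binomial variable `N` with parameters `n` and `p`. -/
def binomExp (p : ℝ) : ℕ → (ℕ → ℝ) → ℝ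
  | 0, f => f 0
  | n + 1, f => p * binomExp p n (fun k => f (k + 1)) + (1 - p) * binomExp p n f

theorem binomExp_add (p : ℝ) (n : ℕ) (f g : ℕ → ℝ) :
    binomExp p n (fun k => f k + g k) = binomExp p n f + binomExp p n g := by
  induction n generalizing f g with
  | zero => rfl
  | succ n ih =>
    simp only [binomExp]
    rw [ih f g, ih (fun k => f (k + 1)) (fun k => g (k + 1))]
    ring

theorem binomExp_mul_left (p : ℝ) (n : ℕ) (a : ℝ) (f : ℕ → ℝ) :
    binomExp p n (fun k => a * f k) = a * binomExp p n f := by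
  induction n generalizing f with
  | zero => rfl
  | succ n ih =>
    simp only [binomExp]
    rw [ih f, ih (fun k => f (k + 1))]
    ring

theorem binomExp_const (p : ℝ) (n : ℕ) (a : ℝ) : binomExp p n (fun _ => a) = a := by
  induction n with
  | zero => rfl
  | succ n ih =>
    simp only [binomExp, ih]
    ring

theorem binomExp_sub (p : ℝ) (n : ℕ) (f g : ℕ → ℝ) :
    binomExp p n (fun k => f k - g k) = binomExp p n f - binomExp p n g := by
  have h := binomExp_add p n f (fun k => -1 * g k)
  rw [binomExp_mul_left] at h
  simpa [sub_eq_add_neg] using h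

theorem binomExp_congr {p : ℝ} {n : ℕ} {f g : ℕ → ℝ} (h : ∀ k, f k = g k) :
    binomExp p n f = binomExp p n g := by
  rw [funext h]

theorem binomExp_mono {p : ℝ} (h0 : 0 ≤ p) (h1 : p ≤ 1) (n : ℕ) {f g : ℕ → ℝ}
    (h : ∀ k, f k ≤ g k) : binomExp p n f ≤ binomExp p n g := by
  induction n generalizing f g with
  | zero => exact h 0
  | succ n ih =>
    simp only [binomExp]
    have := sub_nonneg.2 h1
    gcongr
    · exact ih fun k => h (k + 1)
    · exact ih h

theorem binomExp_nonneg {p : ℝ} (h0 : 0 ≤ p) (h1 : p ≤ 1) (n : ℕ) {f : ℕ → ℝ}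
    (h : ∀ k, 0 ≤ f k) : 0 ≤ binomExp p n f := by
  simpa [binomExp_const] using binomExp_mono h0 h1 n h

theorem abs_binomExp_le {p : ℝ} (h0 : 0 ≤ p) (h1 : p ≤ 1) (n : ℕ) {f g : ℕ → ℝ}
    (h : ∀ k, |f k| ≤ g k) : |binomExp p n f| ≤ binomExp p n g := by
  rw [abs_le]
  constructor
  · have := binomExp_mono h0 h1 n (f := fun k => -1 * g k) (g := f)
      fun k => by linarith [(abs_le.1 (h k)).1]
    rw [binomExp_mul_left] at this
    linarith
  · exact binomExp_mono h0 h1 n fun k => (abs_le.1 (h k)).2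

/-! ### Central moments -/

/-- The central moment of order `j` of the binomial distribution. -/
def centralMoment (p : ℝ) (j n : ℕ) : ℝ :=
  binomExp p n (fun k => ((k : ℝ) - n * p) ^ j)

theorem binomExp_sum {ι : Type*} (p : ℝ) (n : ℕ) (s : Finset ι) (f : ι → ℕ → ℝ) :
    binomExp p n (fun k => ∑ i ∈ s, f i k) = ∑ i ∈ s, binomExp p n (f i) := by
  classical
  induction s using Finset.induction_on with
  | empty => simp [binomExp_const]
  | insert a s ha ih => simp only [Finset.sum_insert ha, binomExp_add, ih]

theorem binomExp_add_pow (p s : ℝ) (j n : ℕ) :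
    binomExp p n (fun k => (((k : ℝ) - n * p) + s) ^ j) =
      ∑ i ∈ Finset.range (j + 1), (s ^ (j - i) * j.choose i) * centralMoment p i n := by
  simp only [add_pow, binomExp_sum, centralMoment, ← binomExp_mul_left]
  exact Finset.sum_congr rfl fun i _ => binomExp_congr fun k => by ring

/-- One further trial shifts the centred count by `1 - p` or by `-p`. The resulting recursion yields
each closed form below by induction on `n`. -/
theorem centralMoment_succ (p : ℝ) (j n : ℕ) :
    centralMoment p j (n + 1) =
      ∑ i ∈ Finset.range (j + 1), ((p * (1 - p) ^ (j - i) + (1 - p) * (-p) ^ (j - i)) *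
        j.choose i) * centralMoment p i n := by
  have : centralMoment p j (n + 1) =
      p * binomExp p n (fun k => (((k : ℝ) - n * p) + (1 - p)) ^ j) +
      (1 - p) * binomExp p n (fun k => (((k : ℝ) - n * p) + -p) ^ j) := by
    simp only [centralMoment, binomExp]
    congr 2 <;> refine binomExp_congr fun k => ?_ <;> push_cast <;> ring
  rw [this, binomExp_add_pow, binomExp_add_pow, Finset.mul_sum, Finset.mul_sum,
    ← Finset.sum_add_distrib]
  exact Finset.sum_congr rfl fun i _ => by ring

theorem centralMoment_zero (p : ℝ) (n : ℕ) : centralMoment p 0 n = 1 := by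
  simp [centralMoment, binomExp_const]

theorem centralMoment_one (p : ℝ) (n : ℕ) : centralMoment p 1 n =
    0 := by
  induction n with
  | zero => simp [centralMoment, binomExp]
  | succ n ih =>
    simp only [centralMoment_succ, Finset.sum_range_succ, Finset.sum_range_zero, ih, centralMoment_zero]
    norm_num [Nat.choose]
    ring

theorem centralMoment_two (p : ℝ) (n : ℕ) : centralMoment p 2 n =
    n * (p * (1 - p)) := by
  induction n with
  | zero => simp [centralMoment, binomExp]
  | succ n ih =>
    simp only [centralMoment_succ, Finset.sum_range_succ, Finset.sum_range_zero, ih, centralMoment_zero, centralMoment_one]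
    norm_num [Nat.choose]
    ring

theorem centralMoment_three (p : ℝ) (n : ℕ) : centralMoment p 3 n =
    n * (p * (1 - p) * (1 - 2 * p)) := by
  induction n with
  | zero => simp [centralMoment, binomExp]
  | succ n ih =>
    simp only [centralMoment_succ, Finset.sum_range_succ, Finset.sum_range_zero, ih, centralMoment_zero, centralMoment_one, centralMoment_two]
    norm_num [Nat.choose]
    ring

theorem centralMoment_four (p : ℝ) (n : ℕ) : centralMoment p 4 n =
    3 * n ^ 2 * (p * (1 - p)) ^ 2 + n * (p * (1 - p) * (1 - 6 * (p * (1 - p)))) := by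
  induction n with
  | zero => simp [centralMoment, binomExp]
  | succ n ih =>
    simp only [centralMoment_succ, Finset.sum_range_succ, Finset.sum_range_zero, ih, centralMoment_zero, centralMoment_one, centralMoment_two, centralMoment_three]
    norm_num [Nat.choose]
    ring

theorem centralMoment_five (p : ℝ) (n : ℕ) : centralMoment p 5 n =
    n * (p * (1 - p) * (1 - 2 * p) * (1 + 2 * (p * (1 - p)) * (5 * n - 6))) := by
  induction n with
  | zero => simp [centralMoment, binomExp]
  | succ n ih =>
    simp only [centralMoment_succ, Finset.sum_range_succ, Finset.sum_range_zero, ih, centralMoment_zero, centralMoment_one, centralMoment_two, centralMoment_three, centralMoment_four]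
    norm_num [Nat.choose]
    ring

theorem centralMoment_six (p : ℝ) (n : ℕ) : centralMoment p 6 n =
    n * (p * (1 - p)) * (1 - 30 * (p * (1 - p)) * (1 - 4 * (p * (1 - p)))
      + 5 * n * (p * (1 - p)) * (5 - 26 * (p * (1 - p))) + 15 * n ^ 2 * (p * (1 - p)) ^ 2) := by
  induction n with
  | zero => simp [centralMoment, binomExp]
  | succ n ih =>
    simp only [centralMoment_succ, Finset.sum_range_succ, Finset.sum_range_zero, ih, centralMoment_zero, centralMoment_one, centralMoment_two, centralMoment_three, centralMoment_four, centralMoment_five]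
    norm_num [Nat.choose]
    ring

/-! ### The relative entropy of a binomial relative frequency -/

theorem binomExp_mulLogTaylor (p : ℝ) (k : ℕ) (y : ℝ) :
    binomExp p k (fun i => mulLogTaylor (y * ((i : ℝ) - k * p))) =
      y * centralMoment p 1 k + y ^ 2 / 2 * centralMoment p 2 k
        + -y ^ 3 / 6 * centralMoment p 3 k + y ^ 4 / 12 * centralMoment p 4 k
        + -y ^ 5 / 20 * centralMoment p 5 k := by
  simp only [centralMoment, ← binomExp_mul_left, ← binomExp_add]
  refine binomExp_congr fun i => ?_
  unfold mulLogTaylor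
  ring

theorem abs_quadratic_le (a b c : ℝ) {u : ℝ} (h0 : 0 ≤ u) (h1 : u ≤ 1) :
    |a + b * u + c * u ^ 2| ≤ |a| + |b| + |c| := by
  have h2 : u ^ 2 ≤ 1 := pow_le_one₀ h0 h1
  calc |a + b * u + c * u ^ 2| ≤ |a + b * u| + |c * u ^ 2| := abs_add_le _ _
    _ ≤ |a| + |b * u| + |c * u ^ 2| := by gcongr; exact abs_add_le _ _
    _ = |a| + |b| * u + |c| * u ^ 2 := by
      rw [abs_mul, abs_mul, abs_of_nonneg h0, abs_of_nonneg (sq_nonneg u)]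
    _ ≤ |a| + |b| + |c| := by
      gcongr
      · exact mul_le_of_le_one_right (abs_nonneg _) h1
      · exact mul_le_of_le_one_right (abs_nonneg _) h2

/-- The expectation of `X log (X / p)`, where `X` is the relative frequency in `k` trials with
probability of success `p`. -/
def freqEntropy (p : ℝ) (k : ℕ) : ℝ :=
  binomExp p k (fun i => (i : ℝ) / k * Real.log ((i : ℝ) / k / p))

theorem freqEntropy_bounds {p : ℝ} (h0 : 0 < p) (h1 : p ≤ 1) {k : ℕ} (hk : 0 < k) :
    p * binomExp p k (fun i => mulLogTaylor (1 / (k * p) * ((i : ℝ) - k * p))) ≤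
        freqEntropy p k ∧
      freqEntropy p k ≤
        p * binomExp p k (fun i => mulLogTaylor (1 / (k * p) * ((i : ℝ) - k * p)))
          + p * (1 / (k * p)) ^ 6 / 5 * centralMoment p 6 k := by
  have hk' : (0 : ℝ) < k := by exact_mod_cast hk
  have et (i : ℕ) : 1 / (k * p) * ((i : ℝ) - k * p) = (i : ℝ) / k / p - 1 := by
    field_simp
  have ef (i : ℕ) : (i : ℝ) / k * Real.log ((i : ℝ) / k / p) =
      p * ((i : ℝ) / k / p * Real.log ((i : ℝ) / k / p)) := by
    field_simp
  have hnn (i : ℕ) : 0 ≤ (i : ℝ) / k / p := by positivity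
  unfold freqEntropy centralMoment
  rw [← binomExp_mul_left, ← binomExp_mul_left, ← binomExp_add]
  constructor
  · refine binomExp_mono h0.le h1 k fun i => ?_
    rw [ef, et]
    exact mul_le_mul_of_nonneg_left (mulLogTaylor_le (hnn i)) h0.le
  · refine binomExp_mono h0.le h1 k fun i => ?_
    have := mul_le_mul_of_nonneg_left (mul_log_le (hnn i)) h0.le
    rw [← et, et] at this
    rw [ef, et]
    refine this.trans (le_of_eq ?_)
    rw [mul_add, ← et]
    ring

theorem exists_freqEntropy_expansion {p : ℝ} (h0 : 0 < p) (h1 : p ≤ 1) :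
    ∃ K : ℝ, 0 ≤ K ∧ ∀ k : ℕ, 0 < k →
      |freqEntropy p k - ((1 - p) / 2 / k + (1 / p - p) / 12 / (k : ℝ) ^ 2)| ≤
        K / (k : ℝ) ^ 3 := by
  obtain ⟨q, hq⟩ : ∃ q, q = 1 - p := ⟨_, rfl⟩
  -- `a₁`, `b₁` are the coefficients of `k⁻³`, `k⁻⁴` left over from the fourth and fifth moments;
  -- `a₂`, `b₂`, `c₂` are those of `k⁻³`, `k⁻⁴`, `k⁻⁵` in the sixth-moment error.
  obtain ⟨a₁, ha₁⟩ : ∃ a, a = q * (1 - 6 * (p * q)) / (12 * p ^ 2)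
    - q ^ 2 * (1 - 2 * p) / (2 * p ^ 2) := ⟨_, rfl⟩
  obtain ⟨b₁, hb₁⟩ : ∃ b, b = -(q * (1 - 2 * p) * (1 - 12 * (p * q)) / (20 * p ^ 3)) := ⟨_, rfl⟩
  obtain ⟨a₂, ha₂⟩ : ∃ a, a = q / (5 * p ^ 4) * (15 * (p * q) ^ 2) := ⟨_, rfl⟩
  obtain ⟨b₂, hb₂⟩ : ∃ a, a = q / (5 * p ^ 4) * (5 * (p * q) * (5 - 26 * (p * q))) := ⟨_, rfl⟩
  obtain ⟨c₂, hc₂⟩ : ∃ a, a = q / (5 * p ^ 4) * (1 - 30 * (p * q) * (1 - 4 * (p * q))) :=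
    ⟨_, rfl⟩
  refine ⟨|a₁| + |b₁| + |0| + (|a₂| + |b₂| + |c₂|), by positivity, fun k hk => ?_⟩
  have hk' : (0 : ℝ) < k := by exact_mod_cast hk
  obtain ⟨lo, hi⟩ := freqEntropy_bounds h0 h1 hk
  set L := p * binomExp p k (fun i => mulLogTaylor (1 / (k * p) * ((i : ℝ) - k * p))) with hL
  have eL : L - ((1 - p) / 2 / k + (1 / p - p) / 12 / (k : ℝ) ^ 2) =
      (a₁ + b₁ * (1 / k) + 0 * (1 / (k : ℝ)) ^ 2) / (k : ℝ) ^ 3 := by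
    rw [hL, binomExp_mulLogTaylor, centralMoment_one, centralMoment_two, centralMoment_three,
      centralMoment_four, centralMoment_five, ha₁, hb₁, hq]
    field_simp
    ring
  have eU : p * (1 / (k * p)) ^ 6 / 5 * centralMoment p 6 k =
      (a₂ + b₂ * (1 / k) + c₂ * (1 / (k : ℝ)) ^ 2) / (k : ℝ) ^ 3 := by
    rw [centralMoment_six, ha₂, hb₂, hc₂, hq]
    field_simp
    ring
  have hu0 : 0 ≤ 1 / (k : ℝ) := by positivity
  have hu1 : 1 / (k : ℝ) ≤ 1 := by
    rw [div_le_one hk']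
    exact_mod_cast hk
  have q1 := abs_le.1 (abs_quadratic_le a₁ b₁ 0 hu0 hu1)
  have q2 := abs_le.1 (abs_quadratic_le a₂ b₂ c₂ hu0 hu1)
  have hk3 : (0 : ℝ) < (k : ℝ) ^ 3 := by positivity
  have r1 := div_le_div_of_nonneg_right q1.1 hk3.le
  have r2 := div_le_div_of_nonneg_right q1.2 hk3.le
  have r4 := div_le_div_of_nonneg_right q2.2 hk3.le
  have r5 : 0 ≤ (|a₂| + |b₂| + |c₂|) / (k : ℝ) ^ 3 := by positivity
  rw [neg_div] at r1
  rw [add_div _ (|a₂| + |b₂| + |c₂|), abs_le]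
  constructor <;> linarith

/-! ### Inverse moments -/

/-- Size-biasing identity. Applied to reciprocals of products it links consecutive inverse rising
moments, at the cost of raising `n` by one. -/
theorem binomExp_id_mul (b : ℝ) (n : ℕ) (g : ℕ → ℝ) :
    binomExp b (n + 1) (fun k => k * g k) = (n + 1) * b * binomExp b n (fun k => g (k + 1)) := by
  induction n generalizing g with
  | zero => simp [binomExp]
  | succ n ih =>
    have e1 : binomExp b (n + 1) (fun k => ((k + 1 : ℕ) : ℝ) * g (k + 1)) =
        binomExp b (n + 1) (fun k => k * g (k + 1)) + binomExp b (n + 1) (fun k => g (k + 1)) := by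
      rw [← binomExp_add]
      refine binomExp_congr fun k => ?_
      push_cast
      ring
    have e2 : binomExp b (n + 1 + 1) (fun k => (k : ℝ) * g k) =
      b * binomExp b (n + 1) (fun k => ((k + 1 : ℕ) : ℝ) * g (k + 1)) +
        (1 - b) * binomExp b (n + 1) (fun k => k * g k) := rfl
    have e3 : binomExp b (n + 1) (fun k => g (k + 1)) =
      b * binomExp b n (fun k => g (k + 1 + 1)) + (1 - b) * binomExp b n (fun k => g (k + 1)) := rfl
    rw [e2, e1, ih, ih, e3]
    push_cast
    ring

/-- The reciprocal of the rising product `(k + 1) ⋯ (k + j)`. -/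
def invRising (j k : ℕ) : ℝ :=
  1 / ((k + 1).ascFactorial j : ℝ)

theorem invRising_one (k : ℕ) : invRising 1 k = 1 / ((k : ℝ) + 1) := by
  simp [invRising, Nat.ascFactorial]

theorem invRising_two (k : ℕ) : invRising 2 k = 1 / (((k : ℝ) + 1) * (k + 2)) := by
  simp only [invRising, Nat.ascFactorial]
  push_cast
  ring_nf

theorem invRising_three (k : ℕ) :
    invRising 3 k = 1 / (((k : ℝ) + 1) * (k + 2) * (k + 3)) := by
  simp only [invRising, Nat.ascFactorial]
  push_cast
  ring_nf

/-- The probability that a binomial variable vanishes. -/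
def zeroProb (b : ℝ) (n : ℕ) : ℝ :=
  binomExp b n (fun k => if k = 0 then 1 else 0)

theorem mul_binomExp_invRising_one (b : ℝ) (n : ℕ) :
    (n + 1) * b * binomExp b n (invRising 1) = 1 - zeroProb b (n + 1) := by
  have h := binomExp_id_mul b n (fun k => 1 / (k : ℝ))
  have e : binomExp b (n + 1) (fun k => (k : ℝ) * (1 / k)) = 1 - zeroProb b (n + 1) := by
    rw [zeroProb, ← binomExp_const b (n + 1) 1, ← binomExp_sub, binomExp_const]
    refine binomExp_congr fun k => ?_
    split_ifs with hk
    · simp [hk]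
    · field_simp
      simp
  rw [← e, h]
  congr 1
  refine binomExp_congr fun k => ?_
  rw [invRising_one]
  push_cast
  rfl

/-- Size-biasing with `g k = 1 / (k (k + 1))`. At `k = 0` the product `k * g k` is `0` while
`invRising 1 0 = 1`, hence the correction by `zeroProb`. -/
theorem mul_binomExp_invRising_two (b : ℝ) (n : ℕ) :
    (n + 1) * b * binomExp b n (invRising 2) =
      binomExp b (n + 1) (invRising 1) - zeroProb b (n + 1) := by
  have h := binomExp_id_mul b n (fun k => 1 / ((k : ℝ) * (k + 1)))
  rw [zeroProb, ← binomExp_sub]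
  convert h.symm using 1
  · congr 1
    refine binomExp_congr fun k => ?_
    rw [invRising_two]
    push_cast
    ring_nf
  · refine binomExp_congr fun k => ?_
    rw [invRising_one]
    split_ifs with hk
    · simp [hk]
    · have : (k : ℝ) ≠ 0 := by exact_mod_cast hk
      have : (k : ℝ) + 1 ≠ 0 := by positivity
      field_simp
      simp

theorem invRising_nonneg (j k : ℕ) : 0 ≤ invRising j k := by
  unfold invRising
  positivity

theorem zeroProb_nonneg {b : ℝ} (h0 : 0 < b) (h1 : b ≤ 1) (n : ℕ) : 0 ≤ zeroProb b n :=
  binomExp_nonneg h0.le h1 n fun k => by split_ifs <;> norm_num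

theorem binomExp_invRising_three_le {b : ℝ} (h0 : 0 < b) (h1 : b ≤ 1) {n : ℕ} (hn : 0 < n) :
    binomExp b n (invRising 3) ≤ 1 / (b ^ 3 * (n : ℝ) ^ 3) := by
  have hn' : (0 : ℝ) < n := by exact_mod_cast hn
  have w3 : (n + 1) * b * binomExp b n (invRising 3) ≤ binomExp b (n + 1) (invRising 2) := by
    have h := binomExp_id_mul b n (fun k => 1 / ((k : ℝ) * (k + 1) * (k + 2)))
    have e : binomExp b n (invRising 3) =
        binomExp b n (fun k => 1 / (((k + 1 : ℕ) : ℝ) * ((k + 1 : ℕ) + 1) * ((k + 1 : ℕ) + 2))) := by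
      refine binomExp_congr fun k => ?_
      rw [invRising_three]
      push_cast
      ring_nf
    rw [e, ← h]
    refine binomExp_mono h0.le h1 _ fun k => ?_
    rw [invRising_two]
    rcases k.eq_zero_or_pos with rfl | hk
    · simp
    · have : (0 : ℝ) < k := by exact_mod_cast hk
      refine le_of_eq ?_
      field_simp
  have w2 := mul_binomExp_invRising_two b (n + 1)
  have w1 := mul_binomExp_invRising_one b (n + 1 + 1)
  have z1 := zeroProb_nonneg h0 h1 (n + 1 + 1)
  have z2 := zeroProb_nonneg h0 h1 (n + 1 + 1 + 1)
  have p1 := binomExp_nonneg h0.le h1 (n + 1 + 1) (invRising_nonneg 1)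
  have p2 := binomExp_nonneg h0.le h1 (n + 1) (invRising_nonneg 2)
  have p3 := binomExp_nonneg h0.le h1 n (invRising_nonneg 3)
  set x1 := binomExp b (n + 1 + 1) (invRising 1)
  set x2 := binomExp b (n + 1) (invRising 2)
  set x3 := binomExp b n (invRising 3)
  push_cast at w1 w2
  have hnb : 0 < n * b := by positivity
  have s1 : n * b * x1 ≤ 1 := by nlinarith [mul_nonneg h0.le p1]
  have s2 : n * b * x2 ≤ x1 := by nlinarith [mul_nonneg h0.le p2]
  have s3 : n * b * x3 ≤ x2 := by nlinarith [mul_nonneg h0.le p3]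
  rw [le_div_iff₀ (by positivity)]
  calc x3 * (b ^ 3 * (n : ℝ) ^ 3) = n * b * (n * b * (n * b * x3)) := by ring
    _ ≤ n * b * (n * b * x2) := by gcongr
    _ ≤ n * b * x1 := by gcongr
    _ ≤ 1 := s1

/-- The indicator of `k = 0` is at most `6 * invRising 3 k`, with equality at `0`. The decay is in
fact exponential, but the order `n⁻³` is all that is needed. -/
theorem zeroProb_le {b : ℝ} (h0 : 0 < b) (h1 : b ≤ 1) {n : ℕ} (hn : 0 < n) :
    zeroProb b n ≤ 6 / b ^ 3 / (n : ℝ) ^ 3 := by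
  have : zeroProb b n ≤ 6 * binomExp b n (invRising 3) := by
    rw [← binomExp_mul_left]
    refine binomExp_mono h0.le h1 n fun k => ?_
    split_ifs with hk
    · rw [hk, invRising_three]
      norm_num
    · exact mul_nonneg (by norm_num) (invRising_nonneg 3 k)
  have := binomExp_invRising_three_le h0 h1 hn
  calc zeroProb b n ≤ 6 * (1 / (b ^ 3 * (n : ℝ) ^ 3)) := by linarith
    _ = _ := by
      field_simp

theorem zeroProb_add_le {b : ℝ} (h0 : 0 < b) (h1 : b ≤ 1) {n : ℕ} (hn : 0 < n) (j : ℕ) :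
    zeroProb b (n + j) ≤ 6 / b ^ 3 / (n : ℝ) ^ 3 := by
  have hn' : (0 : ℝ) < n := by exact_mod_cast hn
  refine (zeroProb_le h0 h1 (by omega)).trans ?_
  gcongr
  omega

theorem abs_binomExp_invRising_one_sub_le {b : ℝ} (h0 : 0 < b) (h1 : b ≤ 1) {n : ℕ}
    (hn : 0 < n) :
    |binomExp b n (invRising 1) - (1 / b / n - 1 / b / (n : ℝ) ^ 2)| ≤
      (1 / b + 6 / b ^ 4) / (n : ℝ) ^ 3 := by
  have hn' : (0 : ℝ) < n := by exact_mod_cast hn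
  have w1 := mul_binomExp_invRising_one b n
  have z0 := zeroProb_nonneg h0 h1 (n + 1)
  have z1 := zeroProb_add_le h0 h1 hn 1
  have e : binomExp b n (invRising 1) - (1 / b / n - 1 / b / (n : ℝ) ^ 2) =
      1 / b * (1 / ((n : ℝ) ^ 2 * (n + 1))) - zeroProb b (n + 1) / ((n + 1) * b) := by
    have : binomExp b n (invRising 1) = (1 - zeroProb b (n + 1)) / ((n + 1) * b) := by
      rw [← w1]
      field_simp
    rw [this]
    field_simp
    ring
  have t1 : 1 / b * (1 / ((n : ℝ) ^ 2 * (n + 1))) ≤ 1 / b * (1 / (n : ℝ) ^ 3) := by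
    gcongr
    nlinarith [sq_nonneg (n : ℝ)]
  have t1' : 0 ≤ 1 / b * (1 / ((n : ℝ) ^ 2 * (n + 1))) := by positivity
  have t2 : zeroProb b (n + 1) / ((n + 1) * b) ≤ 6 / b ^ 4 / (n : ℝ) ^ 3 := by
    calc zeroProb b (n + 1) / ((n + 1) * b) ≤ zeroProb b (n + 1) / (1 * b) := by
          gcongr
          linarith
      _ ≤ (6 / b ^ 3 / (n : ℝ) ^ 3) / (1 * b) := by gcongr
      _ = _ := by field_simp
  have t2' : 0 ≤ zeroProb b (n + 1) / ((n + 1) * b) := by positivity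
  have t3 : (1 / b + 6 / b ^ 4) / (n : ℝ) ^ 3 =
    1 / b * (1 / (n : ℝ) ^ 3) + 6 / b ^ 4 / (n : ℝ) ^ 3 := by ring
  have t4 : 0 ≤ 6 / b ^ 4 / (n : ℝ) ^ 3 := by positivity
  rw [e, t3, abs_le]
  constructor <;> linarith

theorem abs_binomExp_invRising_two_sub_le {b : ℝ} (h0 : 0 < b) (h1 : b ≤ 1) {n : ℕ}
    (hn : 0 < n) :
    |binomExp b n (invRising 2) - 1 / b ^ 2 / (n : ℝ) ^ 2| ≤
      (3 / b ^ 2 + 6 / b ^ 5 + 6 / b ^ 4) / (n : ℝ) ^ 3 := by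
  have hn' : (0 : ℝ) < n := by exact_mod_cast hn
  have w1 := mul_binomExp_invRising_one b (n + 1)
  have w2 := mul_binomExp_invRising_two b n
  have z0 := zeroProb_nonneg h0 h1 (n + 1)
  have z1 := zeroProb_add_le h0 h1 hn 1
  have y0 := zeroProb_nonneg h0 h1 (n + 1 + 1)
  have y1 : zeroProb b (n + 1 + 1) ≤ _ := zeroProb_add_le h0 h1 hn 2
  push_cast at w1
  set z := zeroProb b (n + 1)
  set y := zeroProb b (n + 1 + 1)
  have e : binomExp b n (invRising 2) - 1 / b ^ 2 / (n : ℝ) ^ 2 =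
      -(1 / b ^ 2 * ((3 * n + 2) / ((n : ℝ) ^ 2 * (n + 1) * (n + 2))))
        - y / (((n + 1) * (n + 2)) * b ^ 2) - z / ((n + 1) * b) := by
    have e1 : binomExp b (n + 1) (invRising 1) = (1 - y) / ((n + 1 + 1) * b) := by
      rw [← w1]
      field_simp
    have : binomExp b n (invRising 2) = ((1 - y) / ((n + 1 + 1) * b) - z) / ((n + 1) * b) := by
      rw [← e1, ← w2]
      field_simp
    rw [this]
    field_simp
    ring
  have t1 : 1 / b ^ 2 * ((3 * n + 2) / ((n : ℝ) ^ 2 * (n + 1) * (n + 2))) ≤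
      1 / b ^ 2 * (3 / (n : ℝ) ^ 3) := by
    gcongr 1 / b ^ 2 * ?_
    rw [div_le_div_iff₀ (by positivity) (by positivity)]
    have : 0 < (n : ℝ) ^ 2 := by positivity
    nlinarith
  have t1' : 0 ≤ 1 / b ^ 2 * ((3 * n + 2) / ((n : ℝ) ^ 2 * (n + 1) * (n + 2))) := by positivity
  have t2 : z / ((n + 1) * b) ≤ 6 / b ^ 4 / (n : ℝ) ^ 3 := by
    calc z / ((n + 1) * b) ≤ z / (1 * b) := by
          gcongr
          linarith
      _ ≤ (6 / b ^ 3 / (n : ℝ) ^ 3) / (1 * b) := by gcongr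
      _ = _ := by field_simp
  have t2' : 0 ≤ z / ((n + 1) * b) := by positivity
  have t5 : y / (((n + 1) * (n + 2)) * b ^ 2) ≤ 6 / b ^ 5 / (n : ℝ) ^ 3 := by
    calc y / (((n + 1) * (n + 2)) * b ^ 2) ≤ y / (1 * b ^ 2) := by
          gcongr
          nlinarith
      _ ≤ (6 / b ^ 3 / (n : ℝ) ^ 3) / (1 * b ^ 2) := by gcongr
      _ = _ := by field_simp
  have t5' : 0 ≤ y / (((n + 1) * (n + 2)) * b ^ 2) := by positivity
  have t3 : (3 / b ^ 2 + 6 / b ^ 5 + 6 / b ^ 4) / (n : ℝ) ^ 3 =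
    1 / b ^ 2 * (3 / (n : ℝ) ^ 3) + 6 / b ^ 5 / (n : ℝ) ^ 3 + 6 / b ^ 4 / (n : ℝ) ^ 3 := by ring
  rw [e, t3, abs_le]
  constructor <;> linarith

/-! ### Binomial expectation of the relative entropy -/

/-- Up to third order `1/k` is `invRising 1 k + invRising 2 k` and `1/k²` is `invRising 2 k`. Unlike
powers of `1/k`, these stay meaningful at `k = 0`. -/
theorem exists_freqEntropy_invRising {p : ℝ} (h0 : 0 < p) (h1 : p ≤ 1) :
    ∃ K : ℝ, 0 ≤ K ∧ ∀ k : ℕ,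
      |freqEntropy p k - ((1 - p) / 2 * invRising 1 k +
        ((1 - p) / 2 + (1 / p - p) / 12) * invRising 2 k)| ≤ K * invRising 3 k := by
  obtain ⟨K, hK, h⟩ := exists_freqEntropy_expansion h0 h1
  generalize (1 - p) / 2 = A at *
  generalize (1 / p - p) / 12 = B at *
  -- For `k ≥ 1` the ratios of the error terms to `invRising 3 k` are at most their values `24`,
  -- `8`, `20` at `k = 1`. The case `k = 0` raises `8` to `9`.
  refine ⟨24 * K + 20 * |B| + 9 * |A|, by positivity, fun k => ?_⟩
  rw [invRising_one, invRising_two, invRising_three]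
  rcases k.eq_zero_or_pos with rfl | hk
  · have : freqEntropy p 0 = 0 := by simp [freqEntropy, binomExp]
    rw [this, abs_le]
    have a1 := neg_abs_le A
    have a2 := le_abs_self A
    have b1 := neg_abs_le B
    have b2 := le_abs_self B
    norm_num
    constructor <;> linarith
  have hk' : (1 : ℝ) ≤ k := by exact_mod_cast hk
  have hk0 : (0 : ℝ) < k := by linarith
  set D : ℝ := (k + 1) * (k + 2) * (k + 3) with hD
  have hD0 : 0 < D := by positivity
  have e : freqEntropy p k - (A * (1 / ((k : ℝ) + 1)) + (A + B) * (1 / (((k : ℝ) + 1) * (k + 2)))) =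
      (freqEntropy p k - (A / k + B / (k : ℝ) ^ 2)) + A * (2 / (k * (k + 1) * (k + 2)))
        + B * ((3 * k + 2) / ((k : ℝ) ^ 2 * (k + 1) * (k + 2))) := by
    field_simp
    ring
  have u1 : K / (k : ℝ) ^ 3 ≤ 24 * K * (1 / D) := by
    rw [mul_one_div, div_le_div_iff₀ (by positivity) hD0]
    have : D ≤ 24 * (k : ℝ) ^ 3 := by
      calc D ≤ (2 * k) * (3 * k) * (4 * k) := by
            rw [hD]
            gcongr <;> linarith
        _ = _ := by ring
    nlinarith
  have u2 : 2 / (k * ((k : ℝ) + 1) * (k + 2)) ≤ 8 * (1 / D) := by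
    rw [mul_one_div, div_le_div_iff₀ (by positivity) hD0, hD]
    have : 0 < ((k : ℝ) + 1) * (k + 2) := by positivity
    nlinarith
  have u3 : (3 * k + 2) / ((k : ℝ) ^ 2 * (k + 1) * (k + 2)) ≤ 20 * (1 / D) := by
    rw [mul_one_div, div_le_div_iff₀ (by positivity) hD0, hD]
    have h3 : 0 < ((k : ℝ) + 1) * (k + 2) := by positivity
    have h4 : (3 * (k : ℝ) + 2) * (k + 3) ≤ 20 * k ^ 2 := by nlinarith
    nlinarith [mul_le_mul_of_nonneg_right h4 h3.le]
  have v2 : 0 ≤ 2 / (k * ((k : ℝ) + 1) * (k + 2)) := by positivity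
  have v3 : 0 ≤ (3 * k + 2) / ((k : ℝ) ^ 2 * (k + 1) * (k + 2)) := by positivity
  rw [e]
  refine (abs_add_three _ _ _).trans ?_
  rw [abs_mul, abs_mul, abs_of_nonneg v2, abs_of_nonneg v3]
  have m2 := mul_le_mul_of_nonneg_left u2 (abs_nonneg A)
  have m3 := mul_le_mul_of_nonneg_left u3 (abs_nonneg B)
  have m4 : 0 ≤ |A| * (1 / D) := by positivity
  have := (h k hk).trans u1
  linarith

theorem exists_binomExp_freqEntropy_expansion {p b : ℝ} (h0 : 0 < p) (h1 : p ≤ 1)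
    (hb0 : 0 < b) (hb1 : b ≤ 1) :
    ∃ K : ℝ, ∀ n : ℕ, 0 < n →
      |b * binomExp b n (freqEntropy p) - ((1 - p) / 2 / n +
        ((1 - p) / 2 * (1 - b) + (1 / p - p) / 12) / b / (n : ℝ) ^ 2)| ≤ K / (n : ℝ) ^ 3 := by
  obtain ⟨K, hK, h⟩ := exists_freqEntropy_invRising h0 h1
  generalize (1 - p) / 2 = A at *
  generalize (1 / p - p) / 12 = B at *
  refine ⟨b * (K / b ^ 3 + |A| * (1 / b + 6 / b ^ 4)
    + |A + B| * (3 / b ^ 2 + 6 / b ^ 5 + 6 / b ^ 4)), fun n hn => ?_⟩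
  have hn' : (0 : ℝ) < n := by exact_mod_cast hn
  have s0 := abs_binomExp_le hb0.le hb1 n h
  rw [binomExp_sub, binomExp_add, binomExp_mul_left, binomExp_mul_left, binomExp_mul_left] at s0
  have s3 := mul_le_mul_of_nonneg_left (binomExp_invRising_three_le hb0 hb1 hn) hK
  have s1 := mul_le_mul_of_nonneg_left (abs_binomExp_invRising_one_sub_le hb0 hb1 hn)
    (abs_nonneg A)
  have s2 := mul_le_mul_of_nonneg_left (abs_binomExp_invRising_two_sub_le hb0 hb1 hn)
    (abs_nonneg (A + B))
  rw [← abs_mul] at s1 s2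
  generalize binomExp b n (freqEntropy p) = X at *
  generalize binomExp b n (invRising 1) = w1 at *
  generalize binomExp b n (invRising 2) = w2 at *
  have e : b * X - (A / n + (A * (1 - b) + B) / b / (n : ℝ) ^ 2) =
      b * ((X - (A * w1 + (A + B) * w2)) + A * (w1 - (1 / b / n - 1 / b / (n : ℝ) ^ 2))
        + (A + B) * (w2 - 1 / b ^ 2 / (n : ℝ) ^ 2)) := by
    field_simp
    ring
  rw [e, abs_mul, abs_of_pos hb0, mul_div_assoc]
  gcongr
  refine (abs_add_three _ _ _).trans ?_
  have : K * (1 / (b ^ 3 * (n : ℝ) ^ 3)) = K / b ^ 3 / (n : ℝ) ^ 3 := by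
    field_simp
  rw [add_div, add_div]
  linarith [mul_div_assoc |A| (1 / b + 6 / b ^ 4) ((n : ℝ) ^ 3),
    mul_div_assoc |A + B| (3 / b ^ 2 + 6 / b ^ 5 + 6 / b ^ 4) ((n : ℝ) ^ 3)]

/-! ### Expectations over samples -/

/-- The expectation of `F` over the samples of size `n` from `m`. -/
def sampleExp {C : Type*} [Fintype C] (m : C → ℝ) (n : ℕ) (F : (Fin n → C) → ℝ) : ℝ :=
  ∑ ω : Fin n → C, likelihood m ω * F ω

/-- The number of observations that lie in `G`. -/
def count {C : Type*} [DecidableEq C] {n : ℕ} (ω : Fin n → C) (G : Finset C) : ℕ :=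
  ∑ k, if ω k ∈ G then 1 else 0

theorem count_pos_iff {C : Type*} [DecidableEq C] {n : ℕ} {ω : Fin n → C} {G : Finset C} :
    0 < count ω G ↔ ∃ k, ω k ∈ G := by
  simp [count, Finset.filter_nonempty_iff]

theorem count_eq_sum_singleton {C : Type*} [DecidableEq C] {n : ℕ} (ω : Fin n → C)
    (G : Finset C) : count ω G = ∑ c ∈ G, count ω {c} := by
  simp only [count]
  rw [Finset.sum_comm]
  simp

theorem count_univ {C : Type*} [Fintype C] [DecidableEq C] {n : ℕ} (ω : Fin n → C) :
    count ω Finset.univ = n := by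
  simp [count]

theorem sum_comp_eq_sum_count {C : Type*} [Fintype C] [DecidableEq C] {n : ℕ} (ω : Fin n → C)
    (h : C → ℝ) : ∑ k, h (ω k) = ∑ c, (count ω {c} : ℝ) * h c := by
  simp only [count, Nat.cast_sum, Finset.sum_mul]
  rw [Finset.sum_comm]
  simp

theorem likelihood_nonneg {C : Type*} {n : ℕ} {q : C → ℝ} (hq : ∀ c, 0 ≤ q c)
    (ω : Fin n → C) : 0 ≤ likelihood q ω :=
  Finset.prod_nonneg fun k _ => hq (ω k)

section SampleExp

variable {C : Type*} [Fintype C] {m : C → ℝ}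

theorem sampleExp_succ (n : ℕ) (F : (Fin (n + 1) → C) → ℝ) :
    sampleExp m (n + 1) F =
      ∑ d, m d * sampleExp m n (fun ω => F (Fin.cons d ω : Fin (n + 1) → C)) := by
  unfold sampleExp
  rw [← (Fin.consEquiv (fun _ : Fin (n + 1) => C)).sum_comp, Fintype.sum_prod_type]
  refine Finset.sum_congr rfl fun d _ => ?_
  rw [Finset.mul_sum]
  refine Finset.sum_congr rfl fun ω _ => ?_
  simp [likelihood, Fin.prod_univ_succ, Fin.consEquiv, mul_assoc]

theorem sampleExp_mono (hm : ∀ c, 0 ≤ m c) (n : ℕ) {F G : (Fin n → C) → ℝ}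
    (h : ∀ ω, F ω ≤ G ω) : sampleExp m n F ≤ sampleExp m n G :=
  Finset.sum_le_sum fun ω _ => mul_le_mul_of_nonneg_left (h ω) (likelihood_nonneg hm ω)

theorem sampleExp_sum {ι : Type*} (n : ℕ) (s : Finset ι) (F : ι → (Fin n → C) → ℝ) :
    sampleExp m n (fun ω => ∑ i ∈ s, F i ω) = ∑ i ∈ s, sampleExp m n (F i) := by
  simp only [sampleExp, Finset.mul_sum]
  exact Finset.sum_comm

theorem sampleExp_mul_left (n : ℕ) (a : ℝ) (F : (Fin n → C) → ℝ) :
    sampleExp m n (fun ω => a * F ω) = a * sampleExp m n F := by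
  simp only [sampleExp, Finset.mul_sum]
  exact Finset.sum_congr rfl fun _ _ => by ring

theorem sampleExp_sub (n : ℕ) (F G : (Fin n → C) → ℝ) :
    sampleExp m n (fun ω => F ω - G ω) = sampleExp m n F - sampleExp m n G := by
  simp only [sampleExp, mul_sub, Finset.sum_sub_distrib]

theorem sampleExp_one (hm : ∑ c, m c = 1) (n : ℕ) : sampleExp m n (fun _ => 1) = 1 := by
  induction n with
  | zero => simp [sampleExp, likelihood]
  | succ n ih => simp only [sampleExp_succ, ih, mul_one, hm]

theorem abs_sampleExp_le (hm : ∀ c, 0 ≤ m c) (n : ℕ) {F G : (Fin n → C) → ℝ}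
    (h : ∀ ω, |F ω| ≤ G ω) : |sampleExp m n F| ≤ sampleExp m n G := by
  refine (Finset.abs_sum_le_sum_abs _ _).trans (Finset.sum_le_sum fun ω _ => ?_)
  rw [abs_mul, abs_of_nonneg (likelihood_nonneg hm ω)]
  exact mul_le_mul_of_nonneg_left (h ω) (likelihood_nonneg hm ω)

/-- Given the number of observations in a group, the number of observations in a category of the
group is binomial. -/
theorem sampleExp_count [DecidableEq C] (hm : ∑ c, m c = 1) {G : Finset C} {c : C}
    (hc : c ∈ G) (hb : ∑ d ∈ G, m d ≠ 0) (n : ℕ) (f : ℕ → ℕ → ℝ) :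
    sampleExp m n (fun ω => f (count ω {c}) (count ω G)) =
      binomExp (∑ d ∈ G, m d) n
        (fun k => binomExp (m c / ∑ d ∈ G, m d) k (fun i => f i k)) := by
  induction n generalizing f with
  | zero => simp [sampleExp, likelihood, count, binomExp]
  | succ n ih =>
    have hcons (d : C) (ω : Fin n → C) (H : Finset C) :
        count (Fin.cons d ω : Fin (n + 1) → C) H = count ω H + if d ∈ H then 1 else 0 := by
      simp only [count]
      rw [Fin.sum_univ_succ, add_comm]
      simp only [Fin.cons_zero, Fin.cons_succ]
    set b := ∑ d ∈ G, m d with hbdef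
    have h1 := ih (fun i k => f (i + 1) (k + 1))
    have h2 := ih (fun i k => f i (k + 1))
    have h3 := ih f
    rw [sampleExp_succ]
    simp only [hcons]
    -- Telescoping over the first observation `d`: an unshifted term, a correction for raising the
    -- group count if `d ∈ G`, and one for raising the category count if `d = c`.
    have key (d : C) : m d * sampleExp m n (fun ω =>
        f (count ω {c} + if d ∈ ({c} : Finset C) then 1 else 0)
          (count ω G + if d ∈ G then 1 else 0)) =
        m d * sampleExp m n (fun ω => f (count ω {c}) (count ω G)) +
        (if d ∈ G then m d * (sampleExp m n (fun ω => f (count ω {c}) (count ω G + 1)) -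
          sampleExp m n (fun ω => f (count ω {c}) (count ω G))) else 0) +
        (if d = c then m d * (sampleExp m n (fun ω => f (count ω {c} + 1) (count ω G + 1)) -
          sampleExp m n (fun ω => f (count ω {c}) (count ω G + 1))) else 0) := by
      by_cases hd : d = c
      · subst hd
        simp [hc]
        ring
      · by_cases hG : d ∈ G
        · simp [hd, hG]
          ring
        · simp [hd, hG]
    rw [Finset.sum_congr rfl fun d _ => key d, Finset.sum_add_distrib, Finset.sum_add_distrib,
      ← Finset.sum_mul, hm, Finset.sum_ite_mem, Finset.univ_inter, ← Finset.sum_mul, ← hbdef,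
      Finset.sum_ite_eq' Finset.univ c, if_pos (Finset.mem_univ c), h1, h2, h3]
    simp only [binomExp]
    rw [binomExp_add, binomExp_mul_left, binomExp_mul_left]
    field_simp
    ring

end SampleExp

/-! ### From expectations to the risk -/

theorem HasSecondOrderExpansion.of_abs_sub_le {r : ℕ → ℝ} {a₁ a₂ K : ℝ}
    (h : ∀ n : ℕ, 0 < n → |r n - (a₁ / n + a₂ / (n : ℝ) ^ 2)| ≤ K / (n : ℝ) ^ 3) :
    HasSecondOrderExpansion r a₁ a₂ := by
  have hO : (fun n : ℕ => r n - (a₁ / (n : ℝ) + a₂ / (n : ℝ) ^ 2)) =O[atTop]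
      (fun n : ℕ => 1 / (n : ℝ) ^ 2 * (1 / (n : ℝ))) := by
    refine IsBigO.of_bound K ?_
    filter_upwards [eventually_gt_atTop 0] with n hn
    have hn' : (0 : ℝ) < n := by exact_mod_cast hn
    rw [Real.norm_eq_abs, Real.norm_of_nonneg (by positivity)]
    refine (h n hn).trans (le_of_eq ?_)
    field_simp
  refine hO.trans_isLittleO ?_
  have : (fun n : ℕ => 1 / (n : ℝ)) =o[atTop] (fun _ : ℕ => (1 : ℝ)) :=
    (isLittleO_one_iff ℝ).2 tendsto_one_div_atTop_nhds_zero_nat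
  simpa only [mul_one] using
    (isBigO_refl (fun n : ℕ => 1 / (n : ℝ) ^ 2) atTop).mul_isLittleO this

theorem hasSecondOrderExpansion_risk {C : Type*} [Fintype C] {m : C → ℝ}
    (hm0 : ∀ c, 0 ≤ m c) (hm1 : ∑ c, m c = 1) {S : (n : ℕ) → Set (Fin n → C)}
    {T : (n : ℕ) → (Fin n → C) → C → ℝ} {F : (n : ℕ) → (Fin n → C) → ℝ} {B K L a₁ a₂ : ℝ}
    (hT : ∀ n, 0 < n → ∀ ω ∈ S n, klDivergence (T n ω) m = F n ω)
    (hB : ∀ n ω, |F n ω| ≤ B)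
    (hF : ∀ n : ℕ, 0 < n → |sampleExp m n (F n) - (a₁ / n + a₂ / (n : ℝ) ^ 2)| ≤
      K / (n : ℝ) ^ 3)
    (hS : ∀ n : ℕ, 0 < n → sampleExp m n ((S n)ᶜ.indicator fun _ => 1) ≤ L / (n : ℝ) ^ 3) :
    HasSecondOrderExpansion (risk m S T) a₁ a₂ := by
  refine HasSecondOrderExpansion.of_abs_sub_le (K := K + 2 * (B * L)) fun n hn => ?_
  have hB0 : 0 ≤ B := by
    obtain ⟨c⟩ : Nonempty C := by
      by_contra h
      rw [not_nonempty_iff] at h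
      simp at hm1
    exact (abs_nonneg _).trans (hB 0 (fun _ => c))
  set Y := sampleExp m n ((S n).indicator fun _ => 1) with hY
  set Z := sampleExp m n ((S n)ᶜ.indicator fun _ => 1) with hZ
  set X := sampleExp m n ((S n).indicator (F n)) with hX
  have eY : Y = 1 - Z := by
    have h1 : sampleExp m n (fun ω => 1 - (S n)ᶜ.indicator (fun _ => 1) ω) = 1 - Z := by
      rw [sampleExp_sub, sampleExp_one hm1]
    rw [← h1]
    refine congrArg (sampleExp m n) (funext fun ω => ?_)
    by_cases h : ω ∈ S n
    · rw [Set.indicator_of_mem h, Set.indicator_of_notMem (by simpa using h), sub_zero]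
    · rw [Set.indicator_of_notMem h, Set.indicator_of_mem (by simpa using h), sub_self]
  have hY0 : 0 ≤ Y := by
    have := sampleExp_mono (m := m) hm0 n (F := fun _ => 0 * (1 : ℝ))
      (G := (S n).indicator fun _ => 1) fun ω => by
        rw [zero_mul]; exact Set.indicator_nonneg (fun _ _ => zero_le_one) ω
    rwa [sampleExp_mul_left, zero_mul] at this
  have hXY : |X| ≤ B * Y := by
    rw [hY, ← sampleExp_mul_left]
    refine abs_sampleExp_le hm0 n fun ω => ?_
    by_cases h : ω ∈ S n <;> simp [h, hB]
  have hFX : |sampleExp m n (F n) - X| ≤ B * Z := by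
    rw [hZ, ← sampleExp_mul_left, hX, ← sampleExp_sub]
    refine abs_sampleExp_le hm0 n fun ω => ?_
    by_cases h : ω ∈ S n <;> simp [h, hB]
  have hr : risk m S T n = X / Y := by
    unfold risk
    congr 1
    · refine Finset.sum_congr rfl fun ω _ => ?_
      by_cases h : ω ∈ S n
      · simp [h, hT n hn ω h]
      · simp [h]
    · refine Finset.sum_congr rfl fun ω _ => ?_
      by_cases h : ω ∈ S n <;> simp [h]
  have hZ0 : Z ≤ L / (n : ℝ) ^ 3 := hS n hn
  have hZn : 0 ≤ Z := by
    have := sampleExp_mono (m := m) hm0 n (F := fun _ => 0 * (1 : ℝ))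
      (G := (S n)ᶜ.indicator fun _ => 1) fun ω => by
        rw [zero_mul]; exact Set.indicator_nonneg (fun _ _ => zero_le_one) ω
    rwa [sampleExp_mul_left, zero_mul] at this
  have hq : |X / Y - X| ≤ B * Z := by
    -- If the conditioning event has probability `0`, then `X = 0` and the quotient is `0` by
    -- convention. Otherwise `X / Y - X = (X / Y) * Z`, with `|X / Y| ≤ B`.
    rcases hY0.eq_or_lt with h | h
    · have : X = 0 := by
        rw [← h, mul_zero] at hXY
        exact abs_eq_zero.1 (le_antisymm hXY (abs_nonneg _))
      rw [this]
      simpa using mul_nonneg hB0 hZn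
    · have : X / Y - X = X / Y * Z := by
        have : Z = 1 - Y := by linarith
        rw [this]
        field_simp
      rw [this, abs_mul, abs_div, abs_of_pos h, abs_of_nonneg hZn]
      gcongr
      rwa [div_le_iff₀ h]
  have hBZ : B * Z ≤ B * L / (n : ℝ) ^ 3 := by
    rw [mul_div_assoc]
    gcongr
  have := hF n hn
  rw [hr]
  have e : X / Y - (a₁ / n + a₂ / (n : ℝ) ^ 2) = (X / Y - X) + -(sampleExp m n (F n) - X)
      + (sampleExp m n (F n) - (a₁ / n + a₂ / (n : ℝ) ^ 2)) := by ring
  rw [e]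
  refine (abs_add_three _ _ _).trans ?_
  rw [abs_neg, add_div, mul_div_assoc 2]
  linarith

/-! ### The maximum likelihood estimate -/

section Partition

variable {C : Type*} [Fintype C] [DecidableEq C]

/-- The probability of the group of `c` in the partition `P`. -/
def groupProb (m : C → ℝ) (P : Finpartition (Finset.univ : Finset C)) (c : C) : ℝ :=
  ∑ d ∈ P.part c, m d

/-- The relative frequency of `c` among the observations in its group. -/
def groupFreq {n : ℕ} (P : Finpartition (Finset.univ : Finset C)) (ω : Fin n → C) (c : C) : ℝ :=
  (count ω {c} : ℝ) / count ω (P.part c)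

/-- The probability vectors that give each group of `P` the same probability as `m`. -/
def partitionModel (m : C → ℝ) (P : Finpartition (Finset.univ : Finset C)) : Set (C → ℝ) :=
  {q | q ∈ fullModel C ∧ ∀ G ∈ P.parts, ∑ c ∈ G, q c = ∑ c ∈ G, m c}

theorem sum_parts (P : Finpartition (Finset.univ : Finset C)) (f : C → ℝ) :
    ∑ G ∈ P.parts, ∑ c ∈ G, f c = ∑ c, f c := by
  exact (Finset.sum_biUnion P.disjoint).symm.trans
    (Finset.sum_congr P.biUnion_parts fun _ _ => rfl)

theorem groupProb_eq {P : Finpartition (Finset.univ : Finset C)} (m : C → ℝ) {G : Finset C}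
    (hG : G ∈ P.parts) {c : C} (hc : c ∈ G) : groupProb m P c = ∑ d ∈ G, m d := by
  rw [groupProb, P.part_eq_of_mem hG hc]

theorem groupFreq_eq {P : Finpartition (Finset.univ : Finset C)} {n : ℕ} (ω : Fin n → C)
    {G : Finset C} (hG : G ∈ P.parts) {c : C} (hc : c ∈ G) :
    groupFreq P ω c = (count ω {c} : ℝ) / count ω G := by
  rw [groupFreq, P.part_eq_of_mem hG hc]

theorem groupProb_pos {m : C → ℝ} (hm : ∀ c, 0 < m c)
    (P : Finpartition (Finset.univ : Finset C)) (c : C) : 0 < groupProb m P c :=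
  Finset.sum_pos (fun d _ => hm d) ⟨c, P.mem_part (Finset.mem_univ c)⟩

theorem groupProb_le_one {m : C → ℝ} (hm : ∀ c, 0 < m c) (hm1 : ∑ c, m c = 1)
    (P : Finpartition (Finset.univ : Finset C)) (c : C) : groupProb m P c ≤ 1 := by
  rw [← hm1]
  exact Finset.sum_le_univ_sum_of_nonneg fun d => (hm d).le

theorem le_groupProb {m : C → ℝ} (hm : ∀ c, 0 < m c)
    (P : Finpartition (Finset.univ : Finset C)) (c : C) : m c ≤ groupProb m P c :=
  Finset.single_le_sum (f := m) (fun d _ => (hm d).le) (P.mem_part (Finset.mem_univ c))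

theorem groupFreq_nonneg {n : ℕ} (P : Finpartition (Finset.univ : Finset C)) (ω : Fin n → C)
    (c : C) : 0 ≤ groupFreq P ω c := by
  unfold groupFreq
  positivity

theorem groupFreq_le_one {n : ℕ} (P : Finpartition (Finset.univ : Finset C)) (ω : Fin n → C)
    (c : C) : groupFreq P ω c ≤ 1 := by
  refine div_le_one_of_le₀ ?_ (by positivity)
  rw [count_eq_sum_singleton ω (P.part c)]
  exact_mod_cast Finset.single_le_sum (f := fun d => count ω {d}) (fun d _ => Nat.zero_le _)
    (P.mem_part (Finset.mem_univ c))

theorem sum_groupProb_mul_groupFreq {n : ℕ} (m : C → ℝ)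
    {P : Finpartition (Finset.univ : Finset C)} {ω : Fin n → C} {G : Finset C}
    (hG : G ∈ P.parts) (hω : 0 < count ω G) :
    ∑ c ∈ G, groupProb m P c * groupFreq P ω c = ∑ c ∈ G, m c := by
  have hω' : (count ω G : ℝ) ≠ 0 := by exact_mod_cast hω.ne'
  rw [Finset.sum_congr rfl fun c hc => by rw [groupProb_eq m hG hc, groupFreq_eq ω hG hc],
    ← Finset.mul_sum, ← Finset.sum_div, ← Nat.cast_sum, ← count_eq_sum_singleton,
    div_self hω', mul_one]

theorem mem_partitionModel {n : ℕ} {m : C → ℝ} (hm : ∀ c, 0 < m c) (hm1 : ∑ c, m c = 1)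
    {P : Finpartition (Finset.univ : Finset C)} {ω : Fin n → C}
    (hω : ∀ G ∈ P.parts, 0 < count ω G) :
    (fun c => groupProb m P c * groupFreq P ω c) ∈ partitionModel m P := by
  refine ⟨⟨fun c => mul_nonneg (groupProb_pos hm P c).le (groupFreq_nonneg P ω c), ?_⟩,
    fun G hG => sum_groupProb_mul_groupFreq m hG (hω G hG)⟩
  rw [← sum_parts P, Finset.sum_congr rfl fun G hG => sum_groupProb_mul_groupFreq m hG (hω G hG),
    sum_parts, hm1]

/-- The maximum likelihood estimate of a category probability is the probability of its group,
multiplied by the relative frequency in the group. -/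
theorem IsMLE.eq_groupProb_mul_groupFreq {n : ℕ} {m : C → ℝ} (hm : ∀ c, 0 < m c)
    (hm1 : ∑ c, m c = 1) {P : Finpartition (Finset.univ : Finset C)} {ω : Fin n → C}
    (hω : ∀ G ∈ P.parts, 0 < count ω G) {q : C → ℝ} (hq : IsMLE (partitionModel m P) ω q) :
    q = fun c => groupProb m P c * groupFreq P ω c := by
  set q₀ : C → ℝ := fun c => groupProb m P c * groupFreq P ω c with hq₀
  have hmem : q₀ ∈ partitionModel m P := mem_partitionModel hm hm1 hω
  obtain ⟨⟨⟨hq0, hq1⟩, hqG⟩, hmax⟩ := hq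
  have hpart (c : C) : 0 < count ω (P.part c) :=
    hω _ (P.part_mem.2 (Finset.mem_univ c))
  have hq₀pos (k : Fin n) : 0 < q₀ (ω k) := by
    refine mul_pos (groupProb_pos hm P _) (div_pos ?_ ?_)
    · exact_mod_cast count_pos_iff.2 ⟨k, Finset.mem_singleton_self _⟩
    · exact_mod_cast hpart _
  have hL₀ : 0 < likelihood q₀ ω := Finset.prod_pos fun k _ => hq₀pos k
  have hL : likelihood q₀ ω ≤ likelihood q ω := hmax q₀ hmem
  have hqpos (k : Fin n) : 0 < q (ω k) := by
    refine (hq0 (ω k)).lt_of_ne fun h => ?_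
    have : likelihood q ω = 0 := Finset.prod_eq_zero (Finset.mem_univ k) h.symm
    linarith
  have hlog : 0 ≤ ∑ k, Real.log (q (ω k) / q₀ (ω k)) := by
    rw [← Real.log_prod fun k _ => (div_pos (hqpos k) (hq₀pos k)).ne', Finset.prod_div_distrib]
    exact Real.log_nonneg ((one_le_div hL₀).2 hL)
  -- An observed `c ∈ G` contributes `q c` times `count ω G / b_G`, an unobserved one nothing. As
  -- `q` has total `b_G` on `G`, the group contributes at most `count ω G`.
  have hsum : ∑ k, q (ω k) / q₀ (ω k) ≤ n := by
    rw [sum_comp_eq_sum_count ω (fun c => q c / q₀ c), ← sum_parts P]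
    have hn : (n : ℝ) = ∑ G ∈ P.parts, (count ω G : ℝ) := by
      have h : (n : ℝ) = count ω Finset.univ := by rw [count_univ]
      rw [h, count_eq_sum_singleton, Nat.cast_sum, ← sum_parts P]
      exact Finset.sum_congr rfl fun G _ => by rw [count_eq_sum_singleton ω G, Nat.cast_sum]
    rw [hn]
    refine Finset.sum_le_sum fun G hG => ?_
    obtain ⟨c₀, hc₀⟩ := P.nonempty_of_mem_parts hG
    have hb : 0 < ∑ d ∈ G, m d := Finset.sum_pos (fun d _ => hm d) ⟨c₀, hc₀⟩
    have hG0 : (0 : ℝ) < count ω G := by exact_mod_cast hω G hG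
    calc ∑ c ∈ G, (count ω {c} : ℝ) * (q c / q₀ c)
        ≤ ∑ c ∈ G, q c * (count ω G / ∑ d ∈ G, m d) := by
          refine Finset.sum_le_sum fun c hc => ?_
          rw [hq₀]
          simp only
          rw [groupProb_eq m hG hc, groupFreq_eq ω hG hc]
          rcases (count ω {c}).eq_zero_or_pos with h | h
          · rw [h, Nat.cast_zero, zero_mul]
            exact mul_nonneg (hq0 c) (by positivity)
          · have : (0 : ℝ) < count ω {c} := by exact_mod_cast h
            refine le_of_eq ?_
            field_simp
      _ = count ω G := by
          rw [← Finset.sum_mul, hqG G hG]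
          field_simp
  -- Strictness of `log x < x - 1` for `x ≠ 1` would contradict `hlog` and `hsum`.
  have heq (k : Fin n) : q (ω k) = q₀ (ω k) := by
    by_contra hne
    have hlt : ∑ k, Real.log (q (ω k) / q₀ (ω k)) < ∑ k, (q (ω k) / q₀ (ω k) - 1) := by
      refine Finset.sum_lt_sum
        (fun j _ => Real.log_le_sub_one_of_pos (div_pos (hqpos j) (hq₀pos j)))
        ⟨k, Finset.mem_univ k, Real.log_lt_sub_one_of_pos (div_pos (hqpos k) (hq₀pos k)) ?_⟩
      rwa [Ne, div_eq_one_iff_eq (hq₀pos k).ne']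
    rw [Finset.sum_sub_distrib] at hlt
    simp at hlt
    linarith
  -- On unobserved categories `q₀` vanishes. Since both vectors sum to `1`, domination forces
  -- equality.
  have hle (c : C) : q₀ c ≤ q c := by
    rcases (count ω {c}).eq_zero_or_pos with h | h
    · simp [hq₀, groupFreq, h, hq0 c]
    · obtain ⟨k, hk⟩ := count_pos_iff.1 h
      rw [← Finset.mem_singleton.1 hk]
      exact (heq k).ge
  have := (Finset.sum_eq_sum_iff_of_le fun c _ => hle c).1 (hmem.1.2.trans hq1.symm)
  funext c
  exact (this c (Finset.mem_univ c)).symm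

/-! ### The expansion for a partition -/

/-- The divergence of the estimate that belongs to the partition `P`. -/
def groupDivergence (m : C → ℝ) (P : Finpartition (Finset.univ : Finset C)) {n : ℕ}
    (ω : Fin n → C) : ℝ :=
  ∑ c, groupProb m P c *
    (groupFreq P ω c * Real.log (groupFreq P ω c / (m c / groupProb m P c)))

theorem klDivergence_groupFreq {m : C → ℝ} (hm : ∀ c, 0 < m c)
    (P : Finpartition (Finset.univ : Finset C)) {n : ℕ} (ω : Fin n → C) :
    klDivergence (fun c => groupProb m P c * groupFreq P ω c) m = groupDivergence m P ω := by
  refine Finset.sum_congr rfl fun c _ => ?_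
  have h1 := hm c
  have h2 := groupProb_pos hm P c
  rw [mul_assoc, show groupFreq P ω c / (m c / groupProb m P c) =
    groupProb m P c * groupFreq P ω c / m c by field_simp]

/-- From `1 - 1/t ≤ log t ≤ t - 1` with `t = x / p`, the quantity `x log t` lies between `-1` and `1
/ m c`. -/
theorem abs_groupDivergence_le {m : C → ℝ} (hm : ∀ c, 0 < m c) (hm1 : ∑ c, m c = 1)
    (P : Finpartition (Finset.univ : Finset C)) {n : ℕ} (ω : Fin n → C) :
    |groupDivergence m P ω| ≤ ∑ c, (1 + 1 / m c) := by
  refine (Finset.abs_sum_le_sum_abs _ _).trans (Finset.sum_le_sum fun c _ => ?_)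
  have h1 := hm c
  have h2 := groupProb_pos hm P c
  have h3 := groupProb_le_one hm hm1 P c
  have h4 := groupFreq_nonneg P ω c
  have h5 := groupFreq_le_one P ω c
  have h6 := le_groupProb hm P c
  generalize groupProb m P c = b at *
  generalize groupFreq P ω c = x at *
  generalize m c = y at *
  have hy : 0 < 1 / y := by positivity
  rw [abs_mul, abs_of_pos h2]
  refine (mul_le_of_le_one_left (abs_nonneg _) h3).trans ?_
  rcases h4.eq_or_lt with h | h
  · rw [← h]
    simp
    positivity
  have hp : 0 < x / (y / b) := by positivity
  have l1 := mul_le_mul_of_nonneg_left (Real.log_le_sub_one_of_pos hp) h4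
  have l2 := mul_le_mul_of_nonneg_left (Real.one_sub_inv_le_log_of_pos hp) h4
  have e2 : x * (1 - (x / (y / b))⁻¹) = x - y / b := by field_simp
  have e3 : x / (y / b) ≤ 1 / y := by
    rw [show x / (y / b) = x * b / y by field_simp]
    gcongr
    nlinarith
  have e4 : y / b ≤ 1 := (div_le_one h2).2 h6
  have e5 : x * (x / (y / b) - 1) ≤ 1 / y := by nlinarith
  rw [abs_le]
  constructor <;> linarith

/-- The coefficient of `1 / n` for the partition `P`. -/
def firstCoeff (m : C → ℝ) (P : Finpartition (Finset.univ : Finset C)) : ℝ :=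
  ∑ c, (1 - m c / groupProb m P c) / 2

/-- The coefficient of `1 / n ^ 2` for the partition `P`. -/
def secondCoeff (m : C → ℝ) (P : Finpartition (Finset.univ : Finset C)) : ℝ :=
  ∑ c, ((1 - m c / groupProb m P c) / 2 * (1 - groupProb m P c) +
    (1 / (m c / groupProb m P c) - m c / groupProb m P c) / 12) / groupProb m P c

theorem exists_sampleExp_groupDivergence {m : C → ℝ} (hm : ∀ c, 0 < m c) (hm1 : ∑ c, m c = 1)
    (P : Finpartition (Finset.univ : Finset C)) :
    ∃ K : ℝ, ∀ n : ℕ, 0 < n →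
      |sampleExp m n (groupDivergence m P) -
        (firstCoeff m P / n + secondCoeff m P / (n : ℝ) ^ 2)| ≤ K / (n : ℝ) ^ 3 := by
  have hex (c : C) := exists_binomExp_freqEntropy_expansion
    (div_pos (hm c) (groupProb_pos hm P c))
    ((div_le_one (groupProb_pos hm P c)).2 (le_groupProb hm P c))
    (groupProb_pos hm P c) (groupProb_le_one hm hm1 P c)
  choose K hK using hex
  refine ⟨∑ c, K c, fun n hn => ?_⟩
  have e : sampleExp m n (groupDivergence m P) = ∑ c, groupProb m P c *
      binomExp (groupProb m P c) n (freqEntropy (m c / groupProb m P c)) := by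
    unfold groupDivergence
    rw [sampleExp_sum]
    refine Finset.sum_congr rfl fun c _ => ?_
    rw [sampleExp_mul_left]
    congr 1
    exact sampleExp_count hm1 (P.mem_part (Finset.mem_univ c)) (groupProb_pos hm P c).ne' n
      (fun i k => (i : ℝ) / k * Real.log ((i : ℝ) / k / (m c / groupProb m P c)))
  rw [e, firstCoeff, secondCoeff, Finset.sum_div, Finset.sum_div, ← Finset.sum_add_distrib,
    ← Finset.sum_sub_distrib, Finset.sum_div]
  exact (Finset.abs_sum_le_sum_abs _ _).trans (Finset.sum_le_sum fun c _ => hK c n hn)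

theorem exists_sampleExp_not_observed_le {m : C → ℝ} (hm : ∀ c, 0 < m c) (hm1 : ∑ c, m c = 1)
    (P : Finpartition (Finset.univ : Finset C)) :
    ∃ L : ℝ, ∀ n : ℕ, 0 < n →
      sampleExp m n ({ω | ∀ G ∈ P.parts, ∃ k, ω k ∈ G}ᶜ.indicator fun _ => 1) ≤
        L / (n : ℝ) ^ 3 := by
  refine ⟨∑ c, 6 / groupProb m P c ^ 3, fun n hn => ?_⟩
  have hz (c : C) : sampleExp m n (fun ω => if count ω (P.part c) = 0 then 1 else 0) =
      zeroProb (groupProb m P c) n := by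
    have := sampleExp_count hm1 (P.mem_part (Finset.mem_univ c)) (groupProb_pos hm P c).ne' n
      (fun _ k => if k = 0 then 1 else 0)
    simp only [binomExp_const] at this
    exact this
  calc _ ≤ sampleExp m n (fun ω => ∑ c, if count ω (P.part c) = 0 then 1 else 0) := by
        refine sampleExp_mono (fun c => (hm c).le) n fun ω => ?_
        by_cases h : ∀ G ∈ P.parts, ∃ k, ω k ∈ G
        · rw [Set.indicator_of_notMem (by simpa using h)]
          exact Finset.sum_nonneg fun c _ => by split_ifs <;> norm_num
        · rw [Set.indicator_of_mem (by simpa using h)]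
          push Not at h
          obtain ⟨G, hG, hGω⟩ := h
          obtain ⟨c, hc⟩ := P.nonempty_of_mem_parts hG
          have h0 : count ω (P.part c) = 0 := by
            rw [P.part_eq_of_mem hG hc]
            by_contra hne
            obtain ⟨k, hk⟩ := count_pos_iff.1 (Nat.pos_of_ne_zero hne)
            exact hGω k hk
          refine le_trans ?_ (Finset.single_le_sum
            (f := fun c => if count ω (P.part c) = 0 then (1 : ℝ) else 0)
            (fun c _ => by split_ifs <;> norm_num) (Finset.mem_univ c))
          simp [h0]
    _ = ∑ c, zeroProb (groupProb m P c) n := by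
        rw [sampleExp_sum]
        exact Finset.sum_congr rfl fun c _ => hz c
    _ ≤ ∑ c, 6 / groupProb m P c ^ 3 / (n : ℝ) ^ 3 :=
        Finset.sum_le_sum fun c _ => zeroProb_le (groupProb_pos hm P c)
          (groupProb_le_one hm hm1 P c) hn
    _ = _ := by rw [Finset.sum_div]

theorem sum_div_groupProb {m : C → ℝ} (hm : ∀ c, 0 < m c)
    {P : Finpartition (Finset.univ : Finset C)} {G : Finset C} (hG : G ∈ P.parts) :
    ∑ c ∈ G, m c / ∑ d ∈ G, m d = 1 := by
  obtain ⟨c, hc⟩ := P.nonempty_of_mem_parts hG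
  rw [← Finset.sum_div, div_self (Finset.sum_pos (fun d _ => hm d) ⟨c, hc⟩).ne']

theorem firstCoeff_eq {m : C → ℝ} (hm : ∀ c, 0 < m c)
    (P : Finpartition (Finset.univ : Finset C)) :
    firstCoeff m P = ((Fintype.card C : ℝ) - P.parts.card) / 2 := by
  rw [firstCoeff, ← Finset.sum_div, Finset.sum_sub_distrib,
    ← sum_parts P fun c => m c / groupProb m P c]
  have (G) (hG : G ∈ P.parts) : ∑ c ∈ G, m c / groupProb m P c = 1 := by
    rw [← sum_div_groupProb hm hG]
    exact Finset.sum_congr rfl fun c hc => by rw [groupProb_eq m hG hc]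
  rw [Finset.sum_congr rfl this]
  simp

theorem secondCoeff_eq {m : C → ℝ} (hm : ∀ c, 0 < m c)
    (P : Finpartition (Finset.univ : Finset C)) :
    secondCoeff m P = ∑ G ∈ P.parts,
      (((G.card : ℝ) - 1) / 2 * (1 / (∑ d ∈ G, m d) - 1) - 1 / (∑ d ∈ G, m d) / 12)
        + (∑ c, 1 / m c) / 12 := by
  rw [secondCoeff, ← sum_parts P, ← sum_parts P fun c => 1 / m c, Finset.sum_div,
    ← Finset.sum_add_distrib]
  refine Finset.sum_congr rfl fun G hG => ?_
  obtain ⟨c₀, hc₀⟩ := P.nonempty_of_mem_parts hG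
  have hb : 0 < ∑ d ∈ G, m d := Finset.sum_pos (fun d _ => hm d) ⟨c₀, hc₀⟩
  have h1 := sum_div_groupProb hm hG
  set b := ∑ d ∈ G, m d with hbdef
  have e (c) (hc : c ∈ G) : ((1 - m c / groupProb m P c) / 2 * (1 - groupProb m P c) +
      (1 / (m c / groupProb m P c) - m c / groupProb m P c) / 12) / groupProb m P c =
      (1 / b - 1) / 2 * 1 + (-((1 / b - 1) / 2) - 1 / b / 12) * (m c / b)
        + 1 / 12 * (1 / m c) := by
    rw [groupProb_eq m hG hc, ← hbdef]
    have := hm c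
    field_simp
    ring
  rw [Finset.sum_congr rfl e, Finset.sum_add_distrib, Finset.sum_add_distrib, ← Finset.mul_sum,
    ← Finset.mul_sum, ← Finset.mul_sum, h1, Finset.sum_const, nsmul_eq_mul]
  ring

/-- `P` describes the model and `Q` the conditioning, so that one statement covers the submodel and
both versions of the full model. -/
theorem hasSecondOrderExpansion_risk_of_isMLE {m : C → ℝ} (hm : ∀ c, 0 < m c)
    (hm1 : ∑ c, m c = 1) (P Q : Finpartition (Finset.univ : Finset C))
    {S : (n : ℕ) → Set (Fin n → C)}
    (hQ : ∀ n, {ω | ∀ G ∈ Q.parts, ∃ k, ω k ∈ G} ⊆ S n)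
    (hP : ∀ n, 0 < n → ∀ ω ∈ S n, ∀ G ∈ P.parts, ∃ k, ω k ∈ G)
    {T : (n : ℕ) → (Fin n → C) → C → ℝ}
    (hT : ∀ n, ∀ ω ∈ S n, IsMLE (partitionModel m P) ω (T n ω)) :
    HasSecondOrderExpansion (risk m S T)
      (((Fintype.card C : ℝ) - P.parts.card) / 2) (secondCoeff m P) := by
  obtain ⟨K, hK⟩ := exists_sampleExp_groupDivergence hm hm1 P
  obtain ⟨L, hL⟩ := exists_sampleExp_not_observed_le hm hm1 Q
  rw [← firstCoeff_eq hm]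
  refine hasSecondOrderExpansion_risk (fun c => (hm c).le) hm1
    (F := fun n ω => groupDivergence m P ω) (L := L) (fun n hn ω hω => ?_)
    (fun n ω => abs_groupDivergence_le hm hm1 P ω) hK fun n hn => ?_
  · rw [← klDivergence_groupFreq hm,
      (hT n ω hω).eq_groupProb_mul_groupFreq hm hm1
        fun G hG => count_pos_iff.2 (hP n hn ω hω G hG)]
  · refine (sampleExp_mono (fun c => (hm c).le) n fun ω => ?_).trans (hL n hn)
    exact Set.indicator_le_indicator_of_subset (Set.compl_subset_compl.2 (hQ n))
      (fun _ => zero_le_one) ω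

theorem secondCoeff_indiscrete_lt {m : C → ℝ} (hm : ∀ c, 0 < m c) (hm1 : ∑ c, m c = 1)
    (h : (Finset.univ : Finset C) ≠ ⊥) (P : Finpartition (Finset.univ : Finset C))
    (hcard : 2 ≤ P.parts.card) (h2 : ∀ G ∈ P.parts, 2 ≤ G.card) :
    secondCoeff m (Finpartition.indiscrete h) < secondCoeff m P := by
  rw [secondCoeff_eq hm, secondCoeff_eq hm, Finpartition.indiscrete_parts, Finset.sum_singleton,
    hm1]
  set I : ℝ := (P.parts.card : ℝ) with hI
  have hI2 : 2 ≤ I := by rw [hI]; exact_mod_cast hcard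
  -- With `|G| ≥ 2` a summand is at least `(5/12)(1/b) - 1/2`; then `1/b` is bounded below by its
  -- tangent at `b = 1/I`, where all groups are equally likely.
  have hle : ∑ G ∈ P.parts, (5 / 12 * (2 * I - I ^ 2 * ∑ d ∈ G, m d) - 1 / 2) ≤
      ∑ G ∈ P.parts,
      (((G.card : ℝ) - 1) / 2 * (1 / (∑ d ∈ G, m d) - 1) - 1 / (∑ d ∈ G, m d) / 12) := by
    refine Finset.sum_le_sum fun G hG => ?_
    obtain ⟨c, hc⟩ := P.nonempty_of_mem_parts hG
    have hb : 0 < ∑ d ∈ G, m d := Finset.sum_pos (fun d _ => hm d) ⟨c, hc⟩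
    have hb1 : ∑ d ∈ G, m d ≤ 1 := by
      rw [← hm1]
      exact Finset.sum_le_univ_sum_of_nonneg fun d => (hm d).le
    have hk : (2 : ℝ) ≤ G.card := by exact_mod_cast h2 G hG
    generalize ∑ d ∈ G, m d = b at *
    have h3 : 1 ≤ 1 / b := by rwa [one_le_div hb]
    have h4 : 2 * I - I ^ 2 * b ≤ 1 / b := by
      rw [le_div_iff₀ hb]
      nlinarith [sq_nonneg (I * b - 1)]
    nlinarith
  have hsum : ∑ G ∈ P.parts, (5 / 12 * (2 * I - I ^ 2 * ∑ d ∈ G, m d) - 1 / 2) =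
      5 / 12 * I ^ 2 - I / 2 := by
    rw [Finset.sum_sub_distrib, ← Finset.mul_sum, Finset.sum_sub_distrib, ← Finset.mul_sum,
      ← Finset.mul_sum, sum_parts, hm1]
    simp only [Finset.sum_const, nsmul_eq_mul]
    rw [← hI]
    ring
  -- What remains is `5I² - 6I + 1 = (5I - 1)(I - 1) > 0`.
  rw [hsum] at hle
  norm_num at hle ⊢
  nlinarith

end Partition

/-! ### The groups of an aggregation submodel -/

section Groups

variable {C : Type*} [Fintype C] [DecidableEq C]

/-- The groups of non-overlapping restriction equations form a partition of the categories. -/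
def groupPartition (R : Finset (Finset C)) (hR : NonOverlapping R) :
    Finpartition (Finset.univ : Finset C) where
  parts := groups R
  supIndep := by
    rw [Finset.supIndep_iff_pairwiseDisjoint]
    have hleft (G : Finset C) (hG : G ∈ R) : Disjoint (leftover R) G :=
      Finset.sdiff_disjoint.mono_right (Finset.subset_biUnion_of_mem id hG)
    intro G hG H hH hne
    simp only [groups, Finset.coe_erase, Finset.coe_insert, Set.mem_sdiff, Set.mem_insert_iff,
      Finset.mem_coe] at hG hH
    rcases hG.1 with rfl | hG <;> rcases hH.1 with rfl | hH
    · exact absurd rfl hne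
    · exact hleft H hH
    · exact (hleft G hG).symm
    · exact hR G hG H hH hne
  sup_parts := by
    ext c
    simp only [Finset.mem_sup, id, Finset.mem_univ, iff_true]
    by_cases h : ∃ G ∈ R, c ∈ G
    · obtain ⟨G, hG, hc⟩ := h
      exact ⟨G, Finset.mem_erase.2 ⟨Finset.ne_empty_of_mem hc, Finset.mem_insert_of_mem hG⟩, hc⟩
    · have hc : c ∈ leftover R := by simpa [leftover] using h
      exact ⟨_, Finset.mem_erase.2 ⟨Finset.ne_empty_of_mem hc, Finset.mem_insert_self _ _⟩, hc⟩
  bot_notMem := by simp [groups]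

theorem aggregationSubmodel_eq {m : C → ℝ} {R : Finset (Finset C)} {b : Finset C → ℝ}
    (hm : m ∈ aggregationSubmodel R b) (hR : NonOverlapping R) :
    aggregationSubmodel R b = partitionModel m (groupPartition R hR) := by
  ext q
  refine and_congr_right fun hq => ⟨fun h G hG => ?_, fun h G hG => ?_⟩
  · rcases Finset.mem_insert.1 (Finset.mem_of_mem_erase hG) with rfl | hG'
    · have hsplit (f : C → ℝ) : ∑ c ∈ leftover R, f c = ∑ c, f c - ∑ G ∈ R, ∑ c ∈ G, f c := by
        rw [← Finset.sum_biUnion (t := fun G => G) fun G hG H hH hne => hR G hG H hH hne,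
          eq_sub_iff_add_eq]
        exact Finset.sum_sdiff (Finset.subset_univ _)
      rw [hsplit, hsplit, hq.2, hm.1.2, Finset.sum_congr rfl h, Finset.sum_congr rfl hm.2]
    · rw [h G hG', hm.2 G hG']
  · rw [← hm.2 G hG]
    rcases G.eq_empty_or_nonempty with rfl | hne
    · simp
    · exact h G (Finset.mem_erase.2 ⟨hne.ne_empty, Finset.mem_insert_of_mem hG⟩)

theorem fullModel_eq {m : C → ℝ} (hm1 : ∑ c, m c = 1) (h : (Finset.univ : Finset C) ≠ ⊥) :
    fullModel C = partitionModel m (Finpartition.indiscrete h) := by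
  ext q
  refine ⟨fun hq => ⟨hq, fun G hG => ?_⟩, fun hq => hq.1⟩
  rw [Finpartition.indiscrete_parts, Finset.mem_singleton] at hG
  rw [hG, hm1, hq.2]

end Groups

end

end MAggregation

theorem mainTheorem2 {C : Type*} [Fintype C] [DecidableEq C]
    (m : C → ℝ) (hpos : ∀ c, 0 < m c)
    (R : Finset (Finset C)) (b : Finset C → ℝ)
    (hm : m ∈ MAggregation.aggregationSubmodel R b)
    (hR : MAggregation.NonOverlapping R)
    (hI : 2 ≤ (MAggregation.groups R).card)
    (hsolid : ∀ G ∈ MAggregation.groups R, ¬ MAggregation.IsSolid G) :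
    ∃ aFull aSub : ℝ,
      -- the full model, with all samples or with only those in which every group is observed
      (∀ T : (n : ℕ) → (Fin n → C) → C → ℝ,
        (∀ n ω, MAggregation.IsMLE (MAggregation.fullModel C) ω (T n ω)) →
        MAggregation.HasSecondOrderExpansion
          (MAggregation.risk m (fun _ => Set.univ) T)
          (((Fintype.card C : ℝ) - 1) / 2) aFull ∧
        MAggregation.HasSecondOrderExpansion
          (MAggregation.risk m (MAggregation.observed R) T)
          (((Fintype.card C : ℝ) - 1) / 2) aFull) ∧
      -- the submodel; samples in which some group is not observed are discarded
      (∀ T : (n : ℕ) → (Fin n → C) → C → ℝ,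
        (∀ n, ∀ ω ∈ MAggregation.observed R n,
          MAggregation.IsMLE (MAggregation.aggregationSubmodel R b) ω (T n ω)) →
        MAggregation.HasSecondOrderExpansion
          (MAggregation.risk m (MAggregation.observed R) T)
          (((Fintype.card C : ℝ) - ((MAggregation.groups R).card : ℝ)) / 2) aSub) ∧
      aFull < aSub := by
  have hm1 : ∑ c, m c = 1 := hm.1.2
  have hne : (Finset.univ : Finset C) ≠ ⊥ := by
    rintro h
    rw [h] at hm1
    simp at hm1
  set P := MAggregation.groupPartition R hR with hP
  set F := Finpartition.indiscrete hne with hF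
  have hFS (n : ℕ) (hn : 0 < n) (ω : Fin n → C) (G) (hG : G ∈ F.parts) : ∃ k, ω k ∈ G := by
    rw [hF, Finpartition.indiscrete_parts, Finset.mem_singleton] at hG
    exact ⟨⟨0, hn⟩, hG ▸ Finset.mem_univ _⟩
  have hF1 : (F.parts.card : ℝ) = 1 := by simp [hF]
  refine ⟨MAggregation.secondCoeff m F, MAggregation.secondCoeff m P,
    fun T hT => ?_, fun T hT => ?_, ?_⟩
  · rw [MAggregation.fullModel_eq hm1 hne] at hT
    rw [← hF1]
    exact ⟨MAggregation.hasSecondOrderExpansion_risk_of_isMLE hpos hm1 F P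
        (fun n => Set.subset_univ _) (fun n hn ω _ => hFS n hn ω) fun n ω _ => hT n ω,
      MAggregation.hasSecondOrderExpansion_risk_of_isMLE hpos hm1 F P
        (fun n => subset_rfl) (fun n hn ω _ => hFS n hn ω) fun n ω _ => hT n ω⟩
  · rw [MAggregation.aggregationSubmodel_eq hm hR] at hT
    exact MAggregation.hasSecondOrderExpansion_risk_of_isMLE hpos hm1 P P
      (fun n => subset_rfl) (fun n hn ω hω => hω) hT
  · refine MAggregation.secondCoeff_indiscrete_lt hpos hm1 hne P hI fun G hG => ?_
    have h0 := (P.nonempty_of_mem_parts hG).card_pos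
    have h1 : G.card ≠ 1 := hsolid G hG
    omega
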